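/- **Theorem 3.1.** Let $1\le p\le q$ and $m\ge 0$ be integers and let $$f(z)=H_0(z)e^{w_0z^q}+H_1(z)e^{w_1z^q}+\cdots+H_m(z)e^{w_mz^q}$$ be an exponential polynomial in normalized form: the constants $w_0,\dots,w_m\in\mathbb{C}$ are pairwise distinct and nonzero, except that $w_0=0$ is allowed; each $H_j$ is an exponential polynomial, that is, a finite sum $\sum_i P_i(z)e^{Q_i(z)}$ with polynomials $P_i,Q_i$; and $H_1,\dots,H_m$ do not vanish identically, whereas $H_0\equiv 0$ is allowed. Suppose that the order of growth $$\rho(H_j)=\limsup_{r\to\infty}\frac{\log^+\log^+ M(r,H_j)}{\log r},\qquad M(r,H_j)=\max_{|z|=r}|H_j(z)|,$$ satisfies $\rho(H_j)\le q-p$ for $0\le j\le m$. Set $W_f^0=\{\overline{w}_j: H_j\not\equiv 0\}\cup\{0\}$, and let $C(\operatorname{co}(W_f^0))$ be the circumference of its convex hull, i.e. the sum of the lengths of the sides of this convex polygon, where a segment has circumference twice its length and a point has circumference $0$. Then the Nevanlinna characteristic of $f$ satisfies $$T(r,f)=C(\operatorname{co}(W_f^0))\frac{r^q}{2\pi}+O\left(r^{q-p}+\log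 r\right)\qquad (r\to\infty).$$ -/

import Mathlib

open scoped ComplexConjugate

/-- An exponential polynomial: a finite sum `P₁ e^{Q₁} + ⋯ + Pₙ e^{Qₙ}` with polynomials
`Pᵢ`, `Qᵢ`. -/
def IsExponentialPolynomial (g : ℂ → ℂ) : Prop :=
  ∃ (n : ℕ) (P Q : Fin n → Polynomial ℂ),
    ∀ z : ℂ, g z = ∑ i, (P i).eval z * Complex.exp ((Q i).eval z)

/-- The maximum modulus `M(r, g) = max_{|z| = r} |g(z)|`. -/
noncomputable def maxModulus (g : ℂ → ℂ) (r : ℝ) : ℝ :=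
  sSup ((fun z : ℂ => ‖g z‖) '' Metric.sphere (0 : ℂ) r)

/-- The order of growth `ρ(g) = limsup_{r → ∞} log⁺ log⁺ M(r, g) / log r` of an entire
function. -/
noncomputable def growthOrder (g : ℂ → ℂ) : EReal :=
  Filter.limsup
    (fun r : ℝ => ((Real.posLog (Real.posLog (maxModulus g r)) / Real.log r : ℝ) : EReal))
    Filter.atTop

/-- The positively oriented sides of a convex polygon `K`, as ordered pairs `(u, v)` of distinct
vertices such that `K` lies in the closed half plane to the left of the directed line from `u`
to `v`. A polygon with nonempty interior has each side listed once; a segment (a polygon with two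
vertices) is listed twice, once in each direction; a point has no sides. -/
def orientedSides (K : Set ℂ) : Set (ℂ × ℂ) :=
  {e | e.1 ∈ K.extremePoints ℝ ∧ e.2 ∈ K.extremePoints ℝ ∧ e.1 ≠ e.2 ∧
    ∀ x ∈ K, 0 ≤ (conj (e.2 - e.1) * (x - e.1)).im}

/-- The circumference of a convex polygon: the sum of the lengths of its sides, where a segment is
traversed twice (so that its circumference is twice its length). -/
noncomputable def circumference (K : Set ℂ) : ℝ :=
  ∑ᶠ e ∈ orientedSides K, dist e.1 e.2

/-- The set `W_f` of conjugated leading coefficients of `∑ⱼ Hⱼ(z) e^{wⱼ z^q}`: a leading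
coefficient counts only if its `Hⱼ` does not vanish identically. -/
def conjLeadingCoeffs {m : ℕ} (H : Fin (m + 1) → ℂ → ℂ) (w : Fin (m + 1) → ℂ) : Set ℂ :=
  {x | ∃ j, H j ≠ 0 ∧ x = conj (w j)}

open Real Metric Filter Asymptotics MeasureTheory

/-! Since `f` is entire, `T(r, f)` is the circle average of `log⁺ |f|`. It is compared with the
average of `max (0, max_j Re (w_j z^q))`, which equals `κ r^q` with `κ` the average of `maxRe` over
the unit circle. As `maxRe` is the support function of the hull of `0` and the conjugated
coefficients, Cauchy's formula (`circumference_convexHull_eq`) identifies `2πκ` with the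
circumference.

The upper bound is the triangle inequality once `log M(r, H_j) = O(r^(q-p) + log r)`. The order
hypothesis alone gives only `r^(q-p+ε)`; for exponential polynomials it improves to this bound
(`IsExponentialPolynomial.smallGrowth`).

For the lower bound, the exponentials are isolated by elimination: with some `B ≠ 0` of small
growth, each `B e^(w_j z^q)` is a combination of derivatives of `f` with coefficients of small
growth (`exists_common_denominator`). Cauchy's estimate then bounds `maxRe (z^q)` by the size of
`log⁺ |f|` near `z`, plus small terms, plus `log⁺ |1/B|` (`exists_maxRe_le`). The mean of the last
term is small by the first main theorem. By subharmonicity, the size of `log⁺ |f|` within `δ` of `z`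
is at most its integral over the disc of radius `σ` around `z`, divided by `π (σ-δ)²`. Averaging
over `|z| = r` gives at most `(σ/(σ-δ))² T(r+σ, f)` (`exists_circleAverage_maxRe_le`). With `R = r +
σ`, `σ = R^(1-p)` and `δ = R^(1-2p)` every loss is `O(R^(q-p) + log R)`. -/

/-! ### The growth scale and the differential ring of functions of small growth. -/

/-- The comparison scale `r ^ d + log (r + 2)`. -/
noncomputable def growthScale (d : ℕ) (r : ℝ) : ℝ := r ^ d + Real.log (r + 2)

lemma log_two_le_growthScale (d : ℕ) {r : ℝ} (hr : 0 ≤ r) : Real.log 2 ≤ growthScale d r := by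
  have h1 : Real.log 2 ≤ Real.log (r + 2) := Real.log_le_log (by norm_num) (by linarith)
  have h2 : 0 ≤ r ^ d := by positivity
  unfold growthScale; linarith

lemma growthScale_pos (d : ℕ) {r : ℝ} (hr : 0 ≤ r) : 0 < growthScale d r :=
  lt_of_lt_of_le (Real.log_pos (by norm_num)) (log_two_le_growthScale d hr)

lemma growthScale_mono (d : ℕ) {r s : ℝ} (hr : 0 ≤ r) (hrs : r ≤ s) :
    growthScale d r ≤ growthScale d s := by
  unfold growthScale
  gcongr

lemma growthScale_add_one_le (d : ℕ) {r : ℝ} (hr : 0 ≤ r) :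
    growthScale d (r + 1) ≤ (2 ^ d / Real.log 2 + 2 ^ d + 2) * growthScale d r := by
  have hl2 : 0 < Real.log 2 := Real.log_pos (by norm_num)
  have hl : Real.log 2 ≤ Real.log (r + 2) := Real.log_le_log (by norm_num) (by linarith)
  have h1 : Real.log (r + 1 + 2) ≤ 2 * Real.log (r + 2) := by
    have : Real.log ((r + 2) ^ 2) = 2 * Real.log (r + 2) := by
      rw [Real.log_pow]; norm_num
    rw [← this]
    exact Real.log_le_log (by linarith) (by nlinarith)
  have h2 : (r + 1) ^ d ≤ 2 ^ d * r ^ d + 2 ^ d := by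
    rcases le_total r 1 with h | h
    · have : (r + 1) ^ d ≤ 2 ^ d := by gcongr; linarith
      have : 0 ≤ (2 : ℝ) ^ d * r ^ d := by positivity
      linarith
    · have : (r + 1) ^ d ≤ (2 * r) ^ d := by gcongr; linarith
      rw [mul_pow] at this
      have : 0 ≤ (2 : ℝ) ^ d := by positivity
      linarith
  have h3 : (2 : ℝ) ^ d ≤ 2 ^ d / Real.log 2 * Real.log (r + 2) := by
    rw [div_mul_eq_mul_div, le_div_iff₀ hl2]
    gcongr
  have h4 : 0 ≤ (2 : ℝ) ^ d / Real.log 2 * r ^ d := by positivity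
  have h5 : 0 ≤ (2 : ℝ) ^ d * Real.log (r + 2) := by
    have : 0 ≤ Real.log (r + 2) := hl2.le.trans hl
    positivity
  have h6 : 0 ≤ r ^ d := by positivity
  unfold growthScale
  nlinarith

/-- Entire functions `g` with `log M(r, g) = O(r ^ d + log r)`. -/
def SmallGrowth (d : ℕ) (g : ℂ → ℂ) : Prop :=
  Differentiable ℂ g ∧ ∃ C : ℝ, 0 ≤ C ∧ ∀ z, ‖g z‖ ≤ Real.exp (C * growthScale d ‖z‖)

namespace SmallGrowth

variable {d : ℕ} {g h : ℂ → ℂ}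

/-- The scale uses `log (r + 2)` so that it never drops below `log 2`; a constant factor `A ≤ e^A`
can therefore be absorbed into the exponent. -/
lemma of_norm_le (hg : Differentiable ℂ g) {A C : ℝ} (hA : 0 ≤ A) (hC : 0 ≤ C)
    (h : ∀ z, ‖g z‖ ≤ A * Real.exp (C * growthScale d ‖z‖)) : SmallGrowth d g := by
  have hl2 : 0 < Real.log 2 := Real.log_pos (by norm_num)
  refine ⟨hg, A / Real.log 2 + C, by positivity, fun z => (h z).trans ?_⟩
  rw [add_mul, Real.exp_add]
  gcongr
  have h1 : A ≤ A / Real.log 2 * growthScale d ‖z‖ := by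
    rw [div_mul_eq_mul_div, le_div_iff₀ hl2]
    gcongr
    exact log_two_le_growthScale d (norm_nonneg z)
  exact h1.trans ((by linarith : _ ≤ A / Real.log 2 * growthScale d ‖z‖ + 1).trans
    (Real.add_one_le_exp _))

protected lemma const (c : ℂ) : SmallGrowth d (fun _ => c) :=
  of_norm_le (by fun_prop) (norm_nonneg c) le_rfl (by simp)

protected lemma id : SmallGrowth d (fun z => z) := by
  refine of_norm_le (by fun_prop) zero_le_one zero_le_one fun z => ?_
  rw [one_mul, one_mul, growthScale, Real.exp_add, Real.exp_log (by positivity)]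
  have : 1 ≤ Real.exp (‖z‖ ^ d) := Real.one_le_exp (by positivity)
  nlinarith [norm_nonneg z]

protected lemma add (hg : SmallGrowth d g) (hh : SmallGrowth d h) : SmallGrowth d (g + h) := by
  obtain ⟨hg, C, hC, hgC⟩ := hg
  obtain ⟨hh, D, hD, hhD⟩ := hh
  refine of_norm_le (hg.add hh) (A := 2) (by norm_num) (add_nonneg hC hD) fun z => ?_
  have h0 := (growthScale_pos d (norm_nonneg z)).le
  have h1 : Real.exp (C * growthScale d ‖z‖) ≤ Real.exp ((C + D) * growthScale d ‖z‖) := by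
    gcongr; linarith
  have h2 : Real.exp (D * growthScale d ‖z‖) ≤ Real.exp ((C + D) * growthScale d ‖z‖) := by
    gcongr; linarith
  have h3 : ‖(g + h) z‖ ≤ ‖g z‖ + ‖h z‖ := norm_add_le _ _
  linarith [hgC z, hhD z]

protected lemma mul (hg : SmallGrowth d g) (hh : SmallGrowth d h) : SmallGrowth d (g * h) := by
  obtain ⟨hg, C, hC, hgC⟩ := hg
  obtain ⟨hh, D, hD, hhD⟩ := hh
  refine ⟨hg.mul hh, C + D, add_nonneg hC hD, fun z => ?_⟩
  rw [Pi.mul_apply, norm_mul, add_mul, Real.exp_add]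
  gcongr
  exacts [hgC z, hhD z]

protected lemma neg (hg : SmallGrowth d g) : SmallGrowth d (-g) := by
  obtain ⟨hg, C, hC, hgC⟩ := hg
  exact ⟨hg.neg, C, hC, by simpa using hgC⟩

/-- Cauchy's estimate on the unit circle around `z`: moving from `‖z‖` to `‖z‖ + 1` costs only a
constant factor in the scale. -/
protected lemma deriv (hg : SmallGrowth d g) : SmallGrowth d (_root_.deriv g) := by
  obtain ⟨hg, C, hC, hgC⟩ := hg
  have hl2 : 0 < Real.log 2 := Real.log_pos (by norm_num)
  refine ⟨fun z => (hg.analyticAt z).deriv.differentiableAt,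
    C * (2 ^ d / Real.log 2 + 2 ^ d + 2), by positivity, fun z => ?_⟩
  have := Complex.norm_deriv_le_of_forall_mem_sphere_norm_le (c := z) (R := 1)
    (C := Real.exp (C * growthScale d (‖z‖ + 1))) one_pos hg.diffContOnCl (fun w hw => by
      refine (hgC w).trans ?_
      gcongr
      refine growthScale_mono d (norm_nonneg w) ?_
      rw [mem_sphere_iff_norm] at hw
      calc ‖w‖ = ‖z + (w - z)‖ := by ring_nf
        _ ≤ _ := by rw [← hw]; exact norm_add_le _ _)
  rw [div_one] at this
  refine this.trans ?_
  rw [mul_assoc]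
  gcongr
  exact growthScale_add_one_le d (norm_nonneg z)

end SmallGrowth

/-- The ring of entire functions `g` with `log M(r, g) = O(r ^ d + log r)`. -/
def smallRing (d : ℕ) : Subring (ℂ → ℂ) where
  carrier := {g | SmallGrowth d g}
  mul_mem' := SmallGrowth.mul
  one_mem' := SmallGrowth.const 1
  add_mem' := SmallGrowth.add
  zero_mem' := SmallGrowth.const 0
  neg_mem' := SmallGrowth.neg

lemma mem_smallRing {d : ℕ} {g : ℂ → ℂ} : g ∈ smallRing d ↔ SmallGrowth d g := Iff.rfl

namespace SmallGrowth

variable {d : ℕ}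

lemma polynomial_eval (P : Polynomial ℂ) : SmallGrowth d (fun z => P.eval z) := by
  induction P using Polynomial.induction_on' with
  | add P Q hP hQ =>
    simp only [Polynomial.eval_add]
    exact hP.add hQ
  | monomial n a =>
    simp only [Polynomial.eval_monomial]
    exact (SmallGrowth.const a).mul ((smallRing d).pow_mem (SmallGrowth.id (d := d)) n)

lemma exp_polynomial_eval {Q : Polynomial ℂ} (hQ : Q.natDegree ≤ d) :
    SmallGrowth d (fun z => Complex.exp (Q.eval z)) := by
  have hb : ∀ z : ℂ, ‖Q.eval z‖ ≤ (∑ i ∈ Finset.range (d + 1), ‖Q.coeff i‖) * (1 + ‖z‖ ^ d) := by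
    intro z
    rw [Polynomial.eval_eq_sum_range' (Nat.lt_succ_of_le hQ), Finset.sum_mul]
    refine (norm_sum_le _ _).trans (Finset.sum_le_sum fun i hi => ?_)
    rw [norm_mul, norm_pow]
    gcongr
    rcases le_total ‖z‖ 1 with h | h
    · have := pow_le_one₀ (n := i) (norm_nonneg z) h
      have : 0 ≤ ‖z‖ ^ d := by positivity
      linarith
    · have := pow_le_pow_right₀ h (Nat.lt_succ_iff.1 (Finset.mem_range.1 hi))
      linarith
  set S := ∑ i ∈ Finset.range (d + 1), ‖Q.coeff i‖
  have hS : 0 ≤ S := Finset.sum_nonneg fun _ _ => norm_nonneg _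
  refine of_norm_le (by fun_prop) (Real.exp_pos S).le hS fun z => ?_
  rw [Complex.norm_exp, ← Real.exp_add]
  gcongr
  refine ((Complex.re_le_norm _).trans (hb z)).trans ?_
  have : 0 ≤ Real.log (‖z‖ + 2) := Real.log_nonneg (by linarith [norm_nonneg z])
  unfold growthScale
  nlinarith

protected lemma sum {ι : Type*} {s : Finset ι} {g : ι → ℂ → ℂ} (h : ∀ i ∈ s, SmallGrowth d (g i)) :
    SmallGrowth d (fun z => ∑ i ∈ s, g i z) := by
  have := (smallRing d).sum_mem h
  rwa [mem_smallRing, show ∑ i ∈ s, g i = fun z => ∑ i ∈ s, g i z by ext; simp] at this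

end SmallGrowth

/-! ### Explicit circle averages. -/

lemma circleIntegrable_of_continuous {h : ℂ → ℝ} (hh : Continuous h) (c : ℂ) (r : ℝ) :
    CircleIntegrable h c r :=
  hh.continuousOn.circleIntegrable'

/-- The map `z ↦ z^q` wraps the circle of radius `r` uniformly `q` times around the circle of radius
`r^q`. -/
lemma circleAverage_comp_pow {h : ℂ → ℝ} (hh : Continuous h) {q : ℕ} (hq : q ≠ 0) (r : ℝ) :
    circleAverage (fun z => h (z ^ q)) 0 r = circleAverage h 0 (r ^ q) := by
  unfold circleAverage
  congr 1
  have h1 : ∀ θ : ℝ, h (circleMap 0 r θ ^ q) = (fun φ => h (circleMap 0 (r ^ q) φ)) (q * θ) := by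
    intro θ
    simp only [circleMap_zero]
    congr 1
    rw [mul_pow, ← Complex.exp_nat_mul]
    push_cast
    ring_nf
  simp_rw [h1]
  have hper : Function.Periodic (fun φ => h (circleMap 0 (r ^ q) φ)) (2 * π) := fun φ => by
    simp only [periodic_circleMap 0 (r ^ q) φ]
  have hint : ∀ t₁ t₂, IntervalIntegrable (fun φ => h (circleMap 0 (r ^ q) φ))
      MeasureTheory.volume t₁ t₂ := fun t₁ t₂ =>
    (hh.comp (continuous_circleMap 0 (r ^ q))).intervalIntegrable _ _
  rw [intervalIntegral.integral_comp_mul_left (fun φ => h (circleMap 0 (r ^ q) φ))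
    (by exact_mod_cast hq : (q : ℝ) ≠ 0)]
  have := hper.intervalIntegral_add_zsmul_eq q 0 hint
  simp only [zero_add, zsmul_eq_mul, Int.cast_natCast] at this
  rw [mul_zero, this, smul_eq_mul, ← mul_assoc, inv_mul_cancel₀ (by exact_mod_cast hq), one_mul]

lemma circleAverage_of_homogeneous {h : ℂ → ℝ} (hh : ∀ (t : ℝ) (u : ℂ), 0 ≤ t → h (t * u) = t * h u)
    {r : ℝ} (hr : 0 ≤ r) : circleAverage h 0 r = r * circleAverage h 0 1 := by
  have h1 : ∀ θ : ℝ, h (circleMap 0 r θ) = r * h (circleMap 0 1 θ) := by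
    intro θ
    rw [← hh r _ hr]
    simp [circleMap_zero]
  unfold circleAverage
  simp_rw [h1]
  rw [intervalIntegral.integral_const_mul, smul_eq_mul, smul_eq_mul]
  ring

lemma integral_max_cos_zero : ∫ θ in (0 : ℝ)..2 * π, max (cos θ) 0 = 2 := by
  have hper : Function.Periodic (fun θ => max (cos θ) 0) (2 * π) := fun θ => by
    simp only [cos_periodic θ]
  have h0 := hper.intervalIntegral_add_eq 0 (-(π / 2))
  rw [zero_add] at h0
  have hc : Continuous fun θ => max (cos θ) 0 := by fun_prop
  rw [h0, ← intervalIntegral.integral_add_adjacent_intervals (b := π / 2)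
    (hc.intervalIntegrable _ _) (hc.intervalIntegrable _ _)]
  have h1 : ∫ θ in -(π / 2)..π / 2, max (cos θ) 0 = ∫ θ in -(π / 2)..π / 2, cos θ := by
    refine intervalIntegral.integral_congr fun θ hθ => ?_
    rw [Set.uIcc_of_le (by linarith [pi_pos])] at hθ
    exact max_eq_left (cos_nonneg_of_mem_Icc hθ)
  have h2 : ∫ θ in π / 2..-(π / 2) + 2 * π, max (cos θ) 0
      = ∫ θ in π / 2..-(π / 2) + 2 * π, (0 : ℝ) := by
    refine intervalIntegral.integral_congr fun θ hθ => ?_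
    rw [Set.uIcc_of_le (by linarith [pi_pos])] at hθ
    exact max_eq_right (cos_nonpos_of_pi_div_two_le_of_le hθ.1 (by linarith [hθ.2]))
  rw [h1, h2, integral_cos]
  simp
  norm_num

lemma circleAverage_max_re_mul_zero (a : ℂ) :
    circleAverage (fun z => max (a * z).re 0) 0 1 = ‖a‖ / π := by
  have h1 : ∀ θ : ℝ, max (a * circleMap 0 1 θ).re 0
      = ‖a‖ * (fun φ => max (cos φ) 0) (θ + a.arg) := by
    intro θ
    have h2 : (a * circleMap 0 1 θ).re = ‖a‖ * cos (θ + a.arg) := by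
      conv_lhs => rw [← Complex.norm_mul_exp_arg_mul_I a]
      rw [circleMap_zero, Complex.ofReal_one, one_mul, mul_assoc, ← Complex.exp_add, ← add_mul,
        Complex.re_ofReal_mul, ← Complex.ofReal_add, Complex.exp_ofReal_mul_I_re, add_comm]
    rw [h2]
    simp only [mul_max_of_nonneg _ _ (norm_nonneg a), mul_zero]
  have hper : Function.Periodic (fun θ => max (cos θ) 0) (2 * π) := fun θ => by
    simp only [cos_periodic θ]
  unfold circleAverage
  simp_rw [h1]
  rw [intervalIntegral.integral_const_mul,
    intervalIntegral.integral_comp_add_right (fun φ => max (cos φ) 0), zero_add, add_comm (2 * π),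
    hper.intervalIntegral_add_eq _ 0, zero_add, integral_max_cos_zero, smul_eq_mul]
  field_simp

lemma circleAverage_max_re_mul_pow {q : ℕ} (hq : q ≠ 0) (a : ℂ) {r : ℝ} (hr : 0 ≤ r) :
    circleAverage (fun z => max (a * z ^ q).re 0) 0 r = ‖a‖ / π * r ^ q := by
  rw [circleAverage_comp_pow (h := fun z => max (a * z).re 0) (by fun_prop) hq,
    circleAverage_of_homogeneous _ (by positivity), circleAverage_max_re_mul_zero, mul_comm]
  intro t u ht
  rw [mul_max_of_nonneg _ _ ht, mul_zero, mul_left_comm, Complex.re_ofReal_mul]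

/-! ### Nevanlinna theory of entire functions. -/

lemma continuous_posLog_norm {f : ℂ → ℂ} (hf : Continuous f) : Continuous fun z => log⁺ ‖f z‖ :=
  continuous_posLog.comp hf.norm

lemma logCounting_top_eq_zero {f : ℂ → ℂ} (hf : Differentiable ℂ f) :
    ValueDistribution.logCounting f ⊤ = 0 := by
  have h : 0 ≤ MeromorphicOn.divisor f Set.univ :=
    MeromorphicOn.AnalyticOnNhd.divisor_nonneg (fun z _ => hf.analyticAt z)
  rw [ValueDistribution.logCounting_top, negPart_eq_zero.2 h, map_zero]

lemma characteristic_top_eq_circleAverage {f : ℂ → ℂ} (hf : Differentiable ℂ f) (r : ℝ) :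
    ValueDistribution.characteristic f ⊤ r = circleAverage (fun z => log⁺ ‖f z‖) 0 r := by
  rw [ValueDistribution.characteristic, logCounting_top_eq_zero hf, add_zero,
    ValueDistribution.proximity_top]

lemma Differentiable.meromorphic {f : ℂ → ℂ} (hf : Differentiable ℂ f) : Meromorphic f :=
  fun z => (hf.analyticAt z).meromorphicAt

/-- First main theorem: the proximity function of `1/B` is at most its characteristic, which differs
from that of `B` by a bounded amount. This controls division by `B` on average without locating its
zeros. -/
lemma SmallGrowth.circleAverage_posLog_inv_le {d : ℕ} {B : ℂ → ℂ} (hB : SmallGrowth d B) :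
    ∃ C : ℝ, 0 ≤ C ∧ ∀ r : ℝ, 1 ≤ r →
      circleAverage (fun z => log⁺ ‖(B z)⁻¹‖) 0 r ≤ C * growthScale d r := by
  obtain ⟨hd, C, hC, hBC⟩ := hB
  have hl2 : 0 < Real.log 2 := Real.log_pos (by norm_num)
  set K := max |log ‖B 0‖| |log ‖meromorphicTrailingCoeffAt B 0‖|
  have hK : 0 ≤ K := (abs_nonneg _).trans (le_max_left _ _)
  refine ⟨C + K / Real.log 2, by positivity, fun r hr => ?_⟩
  have hr0 : 0 ≤ r := zero_le_one.trans hr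
  have h1 : circleAverage (fun z => log⁺ ‖(B z)⁻¹‖) 0 r
      ≤ ValueDistribution.characteristic B⁻¹ ⊤ r := by
    rw [ValueDistribution.characteristic, Pi.add_apply, ValueDistribution.proximity_top]
    have := ValueDistribution.logCounting_nonneg (f := B⁻¹) (e := ⊤) hr
    simp only [Pi.inv_apply]
    linarith
  have h2 : ValueDistribution.characteristic B⁻¹ ⊤ r
      ≤ ValueDistribution.characteristic B ⊤ r + K := by
    have := ValueDistribution.characteristic_sub_characteristic_inv_le hd.meromorphic (R := r)
    have := (abs_le.1 this).1
    linarith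
  have h3 : ValueDistribution.characteristic B ⊤ r ≤ C * growthScale d r := by
    rw [characteristic_top_eq_circleAverage hd]
    refine circleAverage_mono_on_of_le_circle
      (circleIntegrable_of_continuous (continuous_posLog_norm hd.continuous) _ _) fun z hz => ?_
    rw [abs_of_nonneg hr0, mem_sphere_zero_iff_norm] at hz
    rw [← hz]
    have h4 : 0 ≤ C * growthScale d ‖z‖ :=
      mul_nonneg hC (growthScale_pos d (norm_nonneg z)).le
    calc log⁺ ‖B z‖ ≤ log⁺ (exp (C * growthScale d ‖z‖)) :=
          posLog_le_posLog (norm_nonneg _) (hBC z)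
      _ = _ := by rw [posLog_apply, log_exp, max_eq_right h4]
  have h5 : K ≤ K / Real.log 2 * growthScale d r := by
    rw [div_mul_eq_mul_div, le_div_iff₀ hl2]
    gcongr
    exact log_two_le_growthScale d hr0
  linarith

lemma circleAverage_le_add_of_le_posLog_inv {h₁ h₂ : ℂ → ℝ} {B : ℂ → ℂ} {r : ℝ}
    (hh₁ : Continuous h₁) (hh₂ : Continuous h₂) (hB : Differentiable ℂ B) (hB0 : B ≠ 0)
    (hr : r ≠ 0) (h : ∀ z ∈ sphere (0 : ℂ) |r|, B z ≠ 0 → h₁ z ≤ h₂ z + log⁺ ‖(B z)⁻¹‖) :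
    circleAverage h₁ 0 r ≤ circleAverage h₂ 0 r + circleAverage (fun z => log⁺ ‖(B z)⁻¹‖) 0 r := by
  classical
  have hci : CircleIntegrable (fun z => log⁺ ‖(B z)⁻¹‖) 0 r :=
    MeromorphicOn.circleIntegrable_posLog_norm
      (f := B⁻¹) fun z _ => (hB.analyticAt z).meromorphicAt.inv
  have hne : ∀ᶠ z in Filter.codiscreteWithin (sphere (0 : ℂ) |r|), B z ≠ 0 := by
    have han : AnalyticOnNhd ℂ B Set.univ := fun z _ => hB.analyticAt z
    obtain ⟨x, hx⟩ := Function.ne_iff.1 hB0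
    exact Filter.codiscreteWithin_mono (Set.subset_univ _) (han.preimage_zero_mem_codiscrete hx)
  -- At a zero of `B` the term `log⁺ ‖(B z)⁻¹‖` takes the default value `0` and the bound may fail.
  -- The majorant is changed there; zeros of `B` are isolated, so its average is unaffected.
  set g : ℂ → ℝ := fun z => if B z = 0 then h₂ z ⊔ h₁ z else h₂ z + log⁺ ‖(B z)⁻¹‖
  have hg : (fun z => h₂ z + log⁺ ‖(B z)⁻¹‖) =ᶠ[Filter.codiscreteWithin (sphere (0 : ℂ) |r|)] g := by
    filter_upwards [hne] with z hz
    simp [g, hz]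
  rw [← circleAverage_fun_add (circleIntegrable_of_continuous hh₂ _ _) hci,
    circleAverage_congr_codiscreteWithin hg hr]
  refine circleAverage_mono (circleIntegrable_of_continuous hh₁ _ _) ?_ fun z hz => ?_
  · exact ((circleIntegrable_of_continuous hh₂ _ _).add hci).congr_codiscreteWithin hg
  · by_cases hz0 : B z = 0
    · simp [g, hz0]
    · simpa [g, hz0] using h z hz hz0

/-- The sub-mean value property of `log⁺ |f|`, from Jensen's formula: zeros inside the disc
contribute nonnegatively. -/
lemma posLog_norm_le_circleAverage {f : ℂ → ℂ} (hf : Differentiable ℂ f) (c : ℂ) (R : ℝ) :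
    log⁺ ‖f c‖ ≤ circleAverage (fun z => log⁺ ‖f z‖) c R := by
  rcases eq_or_ne R 0 with rfl | hR
  · simp
  have hnn : 0 ≤ circleAverage (fun z => log⁺ ‖f z‖) c R :=
    circleAverage_nonneg_of_nonneg fun _ _ => posLog_nonneg
  rcases eq_or_ne (f c) 0 with h0 | h0
  · simpa [h0] using hnn
  rw [posLog_apply]
  refine max_le hnn ?_
  have han : AnalyticOnNhd ℂ f (closedBall c |R|) := fun z _ => hf.analyticAt z
  have h1 := han.circleAverage_log_norm hR h0
  have h2 : 0 ≤ ∑ᶠ u, MeromorphicOn.divisor f (closedBall c |R|) u * log (R * ‖c - u‖⁻¹) := by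
    refine finsum_nonneg fun u => ?_
    by_cases hu : u ∈ closedBall c |R|
    · refine mul_nonneg (by exact_mod_cast MeromorphicOn.AnalyticOnNhd.divisor_nonneg han u) ?_
      -- `R` may be negative, but `log` depends only on the absolute value, and `‖c - u‖ ≤ |R|`. For
      -- `u = c` the argument degenerates to `0`, where `log` is `0`.
      rw [← log_abs, abs_mul, abs_inv, abs_norm]
      rcases eq_or_ne c u with rfl | hcu
      · simp
      · refine log_nonneg ?_
        have : 0 < ‖c - u‖ := norm_pos_iff.2 (sub_ne_zero.2 hcu)
        rw [← div_eq_mul_inv, one_le_div this, norm_sub_rev, ← dist_eq_norm]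
        exact hu
    · rw [Function.locallyFinsuppWithin.apply_eq_zero_of_notMem _ hu]
      simp
  have h3 : circleAverage (fun z => log ‖f z‖) c R ≤ circleAverage (fun z => log⁺ ‖f z‖) c R :=
    circleAverage_mono (MeromorphicOn.circleIntegrable_log_norm
        fun z _ => (hf.analyticAt z).meromorphicAt)
      (circleIntegrable_of_continuous (continuous_posLog_norm hf.continuous) _ _)
      fun z _ => by rw [posLog_apply]; exact le_max_right _ _
  linarith

/-! ### Exponentials against functions of small growth. -/

lemma growthScale_isLittleO {d q : ℕ} (h : d < q) :
    growthScale d =o[atTop] fun r : ℝ => r ^ q := by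
  have h1 : (fun r : ℝ => r ^ d) =o[atTop] fun r : ℝ => r ^ q := isLittleO_pow_pow_atTop_of_lt h
  have h2 : (fun r : ℝ => log (r + 2)) =o[atTop] fun r : ℝ => r ^ q := by
    have h3 : (fun r : ℝ => log (r + 2)) =o[atTop] fun r : ℝ => r + 2 :=
      isLittleO_log_id_atTop.comp_tendsto (tendsto_atTop_add_const_right _ 2 tendsto_id)
    refine h3.trans_isBigO (IsBigO.of_bound 3 ?_)
    filter_upwards [eventually_ge_atTop 1] with r hr
    rw [norm_of_nonneg (by linarith), norm_of_nonneg (by positivity)]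
    have : r ≤ r ^ q := le_self_pow₀ hr (by omega)
    linarith
  exact h1.add h2

lemma eventually_mul_growthScale_lt {d q : ℕ} (h : d < q) (C : ℝ) {A : ℝ} (hA : 0 < A) :
    ∀ᶠ r : ℝ in atTop, C * growthScale d r < A * r ^ q := by
  have h1 := (growthScale_isLittleO h).def (c := A / (|C| + 1)) (by positivity)
  filter_upwards [h1, eventually_ge_atTop 1] with r hr hr1
  have hg := growthScale_pos d (zero_le_one.trans hr1)
  rw [norm_of_nonneg hg.le, norm_of_nonneg (by positivity), div_mul_eq_mul_div,
    le_div_iff₀ (by positivity)] at hr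
  have h2 : C * growthScale d r ≤ |C| * growthScale d r := by gcongr; exact le_abs_self C
  nlinarith

lemma posLog_le_of_le_exp {x y : ℝ} (hx : 0 ≤ x) (hy : 0 ≤ y) (h : x ≤ exp y) : log⁺ x ≤ y :=
  (posLog_le_posLog hx h).trans (by rw [posLog_apply, log_exp, max_eq_right hy])

lemma posLog_norm_exp (x : ℂ) : log⁺ ‖Complex.exp x‖ = max x.re 0 := by
  rw [Complex.norm_exp, posLog_apply, log_exp, max_comm]

lemma SmallGrowth.posLog_norm_le {d : ℕ} {g : ℂ → ℂ} (hg : SmallGrowth d g) :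
    ∃ C : ℝ, 0 ≤ C ∧ ∀ z, log⁺ ‖g z‖ ≤ C * growthScale d ‖z‖ := by
  obtain ⟨_, C, hC, h⟩ := hg
  exact ⟨C, hC, fun z => posLog_le_of_le_exp (norm_nonneg _)
    (mul_nonneg hC (growthScale_pos d (norm_nonneg z)).le) (h z)⟩

lemma circleAverage_posLog_norm_le {f : ℂ → ℂ} (hf : Continuous f) {r A : ℝ}
    (h : ∀ z : ℂ, ‖z‖ = |r| → log⁺ ‖f z‖ ≤ A) :
    circleAverage (fun z => log⁺ ‖f z‖) 0 r ≤ A :=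
  circleAverage_mono_on_of_le_circle
    (circleIntegrable_of_continuous (continuous_posLog_norm hf) _ _) fun z hz =>
      h z (mem_sphere_zero_iff_norm.1 hz)

/-- A quotient of two functions of small growth is never `e ^ (a z ^ q)` with `a ≠ 0`, `q > d`. -/
lemma SmallGrowth.mul_exp_ne {d q : ℕ} (hdq : d < q) {a : ℂ} (ha : a ≠ 0) {G H : ℂ → ℂ}
    (hG : SmallGrowth d G) (hH : SmallGrowth d H) (hH0 : H ≠ 0)
    (h : ∀ z, H z * Complex.exp (a * z ^ q) = G z) : False := by
  obtain ⟨C, hC, hGC⟩ := hG.posLog_norm_le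
  obtain ⟨D, hD, hHD⟩ := hH.circleAverage_posLog_inv_le
  have ha' : 0 < ‖a‖ / π := div_pos (norm_pos_iff.2 ha) pi_pos
  obtain ⟨r, hr1, hr⟩ := ((eventually_ge_atTop 1).and
    (eventually_mul_growthScale_lt hdq (C + D) ha')).exists
  have hr0 : 0 ≤ r := zero_le_one.trans hr1
  -- Since `e^(a z^q) = G / H`, the average `‖a‖ / π * r^q` of its `log⁺` would be at most a
  -- multiple of `growthScale d r`, impossible for large `r`.
  have h1 := circleAverage_le_add_of_le_posLog_inv (h₁ := fun z => max (a * z ^ q).re 0)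
    (h₂ := fun z => log⁺ ‖G z‖) (B := H) (r := r) (by fun_prop)
    (continuous_posLog_norm hG.1.continuous) hH.1 hH0 (by linarith) (fun z _ hz => by
      rw [← posLog_norm_exp, show Complex.exp (a * z ^ q) = G z * (H z)⁻¹ by
        rw [← h z]; field_simp, norm_mul]
      exact posLog_mul)
  rw [circleAverage_max_re_mul_pow (by omega) a hr0] at h1
  have h2 := circleAverage_posLog_norm_le hG.1.continuous (r := r) (A := C * growthScale d r)
    fun z hz => by
      rw [abs_of_nonneg hr0] at hz
      rw [← hz]; exact hGC z
  linarith [hHD r hr1]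

/-- The logarithmic Wronskian of `G` and `H e ^ (a z ^ q)` does not vanish identically. -/
lemma SmallGrowth.wronskian_ne_zero {d q : ℕ} (hdq : d < q) {a : ℂ} (ha : a ≠ 0) {G H : ℂ → ℂ}
    (hG : SmallGrowth d G) (hH : SmallGrowth d H) (hG0 : G ≠ 0) (hH0 : H ≠ 0) :
    (fun z => G z * deriv H z - deriv G z * H z + a * (q * z ^ (q - 1)) * (G z * H z)) ≠ 0 := by
  intro hW
  obtain ⟨x, hx⟩ := Function.ne_iff.1 hG0
  have hne : ∀ᶠ z in nhds x, G z ≠ 0 := hG.1.continuous.continuousAt.eventually_ne hx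
  obtain ⟨ε, hε, hball⟩ := Metric.eventually_nhds_iff_ball.1 hne
  set E : ℂ → ℂ := fun z => Complex.exp (a * z ^ q)
  have hE : Differentiable ℂ E := by fun_prop
  have hE' : ∀ z, HasDerivAt E (E z * (a * (q * z ^ (q - 1)))) z := fun z =>
    ((hasDerivAt_pow q z).const_mul a).cexp
  -- The expression in `hW`, times `E / G²`, is the derivative of `H E / G`. So this quotient is
  -- constant near a point where `G ≠ 0`, and the identity theorem gives `H E = c G` everywhere.
  have hconst : ∀ z ∈ ball x ε, H z * E z / G z = H x * E x / G x := by
    intro z hz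
    have hd : ∀ y ∈ ball x ε, HasDerivAt (fun z => H z * E z / G z) 0 y := by
      intro y hy
      have h1 := (((hH.1 y).hasDerivAt.mul (hE' y)).div (hG.1 y).hasDerivAt (hball y hy))
      refine h1.congr_deriv ?_
      have h2 := congrFun hW y
      simp only [Pi.zero_apply] at h2
      rw [div_eq_zero_iff]
      left
      simp only [Pi.mul_apply]
      linear_combination E y * h2
    exact (isOpen_ball.is_const_of_deriv_eq_zero (convex_ball x ε).isPreconnected
      (fun y hy => (hd y hy).differentiableAt.differentiableWithinAt)
      (fun y hy => (hd y hy).deriv) hz (mem_ball_self hε))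
  set c := H x * E x / G x
  have heq : (fun z => H z * E z) = fun z => c * G z := by
    refine AnalyticOnNhd.eq_of_eventuallyEq (𝕜 := ℂ) (z₀ := x)
      (fun z _ => (hH.1.mul hE).analyticAt z) (fun z _ => (hG.1.const_mul c).analyticAt z) ?_
    filter_upwards [ball_mem_nhds x hε] with z hz
    have := hconst z hz
    rwa [div_eq_iff (hball z hz)] at this
  exact SmallGrowth.mul_exp_ne hdq ha ((SmallGrowth.const c).mul hG) hH hH0 (congrFun heq)

/-! ### Elimination of exponentials by derivatives. -/

/-- The linear span of the derivatives of `f` over the ring of functions of small growth. -/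
noncomputable def derivModule (d : ℕ) (f : ℂ → ℂ) : Submodule (smallRing d) (ℂ → ℂ) :=
  Submodule.span (smallRing d) (Set.range fun k => iteratedDeriv k f)

section derivModule

variable {d : ℕ} {f g : ℂ → ℂ}

lemma self_mem_derivModule (d : ℕ) (f : ℂ → ℂ) : f ∈ derivModule d f :=
  Submodule.subset_span ⟨0, iteratedDeriv_zero⟩

lemma SmallGrowth.mul_mem_derivModule {a : ℂ → ℂ} (ha : SmallGrowth d a)
    (hg : g ∈ derivModule d f) : a * g ∈ derivModule d f :=
  (derivModule d f).smul_mem ⟨a, ha⟩ hg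

lemma Differentiable.iteratedDeriv (hf : Differentiable ℂ f) (k : ℕ) :
    Differentiable ℂ (iteratedDeriv k f) :=
  hf.contDiff.differentiable_iteratedDeriv k (WithTop.coe_lt_top _)

lemma deriv_mem_derivModule (hf : Differentiable ℂ f) (hg : g ∈ derivModule d f) :
    Differentiable ℂ g ∧ deriv g ∈ derivModule d f := by
  induction hg using Submodule.span_induction with
  | mem x hx =>
    obtain ⟨k, rfl⟩ := hx
    exact ⟨hf.iteratedDeriv k, Submodule.subset_span ⟨k + 1, iteratedDeriv_succ⟩⟩
  | zero =>
    refine ⟨by fun_prop, ?_⟩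
    rw [show deriv (0 : ℂ → ℂ) = 0 by ext z; simp]
    exact zero_mem _
  | add x y _ _ hx hy =>
    refine ⟨hx.1.add hy.1, ?_⟩
    rw [show deriv (x + y) = deriv x + deriv y by ext z; exact deriv_add (hx.1 z) (hy.1 z)]
    exact add_mem hx.2 hy.2
  | smul a x hx' hx =>
    obtain ⟨a, ha⟩ := a
    have ha' : SmallGrowth d a := ha
    refine ⟨ha'.1.mul hx.1, ?_⟩
    rw [show deriv ((⟨a, ha⟩ : smallRing d) • x) = deriv a * x + a * deriv x by
      ext z; exact deriv_mul (ha'.1 z) (hx.1 z)]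
    exact add_mem (ha'.deriv.mul_mem_derivModule hx') (ha'.mul_mem_derivModule hx.2)

/-- Lets the elimination be iterated: whatever is obtained from a reduced sum is also obtained from
the original one. -/
lemma derivModule_le (hf : Differentiable ℂ f) (hg : g ∈ derivModule d f) :
    derivModule d g ≤ derivModule d f := by
  refine Submodule.span_le.2 ?_
  rintro _ ⟨k, rfl⟩
  induction k with
  | zero => simpa using hg
  | succ k ih =>
    simp only [iteratedDeriv_succ]
    exact (deriv_mem_derivModule hf ih).2

/-- Cauchy's estimate for the elements of `derivModule d f`. -/
lemma exists_norm_le_of_mem_derivModule (hf : Differentiable ℂ f) (hg : g ∈ derivModule d f) :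
    ∃ (N : ℕ) (C : ℝ), 0 ≤ C ∧ ∀ (z : ℂ) (δ M : ℝ), 0 < δ → δ ≤ 1 →
      (∀ ζ ∈ closedBall z δ, ‖f ζ‖ ≤ M) →
        ‖g z‖ ≤ exp (C * growthScale d ‖z‖) * (δ⁻¹ ^ N * M) := by
  have hl2 : 0 < Real.log 2 := Real.log_pos (by norm_num)
  have hM : ∀ {z : ℂ} {δ M : ℝ}, 0 < δ → (∀ ζ ∈ closedBall z δ, ‖f ζ‖ ≤ M) → 0 ≤ M :=
    fun {z} _ _ hδ h => (norm_nonneg _).trans (h z (mem_closedBall_self hδ.le))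
  induction hg using Submodule.span_induction with
  | mem x hx =>
    obtain ⟨k, rfl⟩ := hx
    refine ⟨k, log k.factorial / log 2, by positivity, fun z δ M hδ hδ1 h => ?_⟩
    have h1 := Complex.norm_iteratedDeriv_le_of_forall_mem_sphere_norm_le (n := k) hδ
      hf.diffContOnCl (fun ζ hζ => h ζ (sphere_subset_closedBall hζ))
    refine h1.trans ?_
    rw [mul_div_assoc, div_eq_inv_mul, inv_pow]
    have := hM hδ h
    gcongr
    rw [← log_le_iff_le_exp (by positivity), div_mul_eq_mul_div, le_div_iff₀ hl2]
    gcongr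
    exact log_two_le_growthScale d (norm_nonneg z)
  | zero =>
    refine ⟨0, 0, le_rfl, fun z δ M hδ hδ1 h => ?_⟩
    simpa using hM hδ h
  | add x y _ _ hx hy =>
    obtain ⟨N₁, C₁, hC₁, h₁⟩ := hx
    obtain ⟨N₂, C₂, hC₂, h₂⟩ := hy
    -- The extra `1` pays for the factor `2` of the triangle inequality, because `2 ≤ exp
    -- (growthScale d ‖z‖)`.
    refine ⟨N₁ + N₂, C₁ + C₂ + 1, by positivity, fun z δ M hδ hδ1 h => ?_⟩
    have hM0 := hM hδ h
    have hδ2 : 1 ≤ δ⁻¹ := one_le_inv_iff₀.2 ⟨hδ, hδ1⟩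
    have hg0 := (growthScale_pos d (norm_nonneg z)).le
    have h3 : ‖x z‖ ≤ exp ((C₁ + C₂) * growthScale d ‖z‖) * (δ⁻¹ ^ (N₁ + N₂) * M) := by
      refine (h₁ z δ M hδ hδ1 h).trans ?_
      gcongr <;> linarith
    have h4 : ‖y z‖ ≤ exp ((C₁ + C₂) * growthScale d ‖z‖) * (δ⁻¹ ^ (N₁ + N₂) * M) := by
      refine (h₂ z δ M hδ hδ1 h).trans ?_
      gcongr <;> linarith
    have h5 : 2 ≤ exp (growthScale d ‖z‖) := by
      rw [← log_le_iff_le_exp two_pos]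
      exact log_two_le_growthScale d (norm_nonneg z)
    rw [add_mul _ 1, one_mul, exp_add]
    have h6 : 0 ≤ exp ((C₁ + C₂) * growthScale d ‖z‖) * (δ⁻¹ ^ (N₁ + N₂) * M) := by positivity
    calc ‖(x + y) z‖ ≤ ‖x z‖ + ‖y z‖ := norm_add_le _ _
      _ ≤ 2 * (exp ((C₁ + C₂) * growthScale d ‖z‖) * (δ⁻¹ ^ (N₁ + N₂) * M)) := by linarith
      _ ≤ exp (growthScale d ‖z‖) * (exp ((C₁ + C₂) * growthScale d ‖z‖) * (δ⁻¹ ^ (N₁ + N₂) * M)) :=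
        by gcongr
      _ = _ := by ring
  | smul a x _ hx =>
    obtain ⟨a, ha⟩ := a
    obtain ⟨ha, D, hD, haD⟩ : SmallGrowth d a := ha
    obtain ⟨N, C, hC, h₁⟩ := hx
    refine ⟨N, D + C, by positivity, fun z δ M hδ hδ1 h => ?_⟩
    rw [add_mul, exp_add, mul_assoc]
    calc ‖a z * x z‖ = ‖a z‖ * ‖x z‖ := norm_mul _ _
      _ ≤ _ := mul_le_mul (haD z) (h₁ z δ M hδ hδ1 h) (norm_nonneg _) (exp_pos _).le

end derivModule

/-- Each exponential in `f = ∑ Hᵢ e ^ (wᵢ z ^ q)` is, up to a factor of small growth, a linear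
combination of derivatives of `f` with coefficients of small growth. -/
lemma exists_mul_exp_mem_derivModule {ι : Type*} [DecidableEq ι] {d q : ℕ} (hdq : d < q)
    (w : ι → ℂ) (n : ℕ) : ∀ (s : Finset ι), s.card = n → Set.InjOn w s → ∀ (H : ι → ℂ → ℂ),
      (∀ i ∈ s, SmallGrowth d (H i)) → (∀ i ∈ s, H i ≠ 0) → ∀ j ∈ s,
      ∃ B, SmallGrowth d B ∧ B ≠ 0 ∧ (B * fun z => Complex.exp (w j * z ^ q)) ∈
        derivModule d (fun z => ∑ i ∈ s, H i z * Complex.exp (w i * z ^ q)) := by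
  induction n with
  | zero =>
    intro s hs _ H _ _ j hj
    simp [Finset.card_eq_zero.1 hs] at hj
  | succ n ih =>
    intro s hs hw H hH hH0 j hj
    by_cases hij : ∃ i ∈ s, i ≠ j
    · obtain ⟨i, hi, hij⟩ := hij
      set f : ℂ → ℂ := fun z => ∑ i ∈ s, H i z * Complex.exp (w i * z ^ q) with hfdef
      have hderiv : ∀ z, HasDerivAt f (∑ k ∈ s, (deriv (H k) z * Complex.exp (w k * z ^ q)
          + H k z * (Complex.exp (w k * z ^ q) * (w k * (q * z ^ (q - 1)))))) z := fun z =>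
        HasDerivAt.fun_sum fun k hk => ((hH k hk).1 z).hasDerivAt.mul
          ((hasDerivAt_pow q z).const_mul (w k)).cexp
      have hf : Differentiable ℂ f := fun z => (hderiv z).differentiableAt
      -- These are the coefficients of `H i * f' - (H i' + w i * q z^(q-1) * H i) * f`. The operator
      -- kills the `i`-th term and keeps every other one nonzero by `wronskian_ne_zero`, so the sum
      -- gets one term shorter.
      set H' : ι → ℂ → ℂ := fun k z => H i z * deriv (H k) z - deriv (H i) z * H k z
        + (w k - w i) * (q * z ^ (q - 1)) * (H i z * H k z) with hH'def
      have hpow : SmallGrowth d (fun z => (q : ℂ) * z ^ (q - 1)) := by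
        have := SmallGrowth.polynomial_eval (d := d)
          (Polynomial.C (q : ℂ) * Polynomial.X ^ (q - 1))
        simpa only [Polynomial.eval_mul, Polynomial.eval_C, Polynomial.eval_pow,
          Polynomial.eval_X] using this
      have hHi := hH i hi
      have hH's : ∀ k ∈ s.erase i, SmallGrowth d (H' k) := fun k hk => by
        have hHk := hH k (Finset.mem_of_mem_erase hk)
        have := ((hHi.mul hHk.deriv).add (hHi.deriv.mul hHk).neg).add
          (((SmallGrowth.const (w k - w i)).mul hpow).mul (hHi.mul hHk))
        convert this using 1
        ext z
        simp [hH'def, sub_eq_add_neg]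
      have hH'0 : ∀ k ∈ s.erase i, H' k ≠ 0 := fun k hk =>
        hHi.wronskian_ne_zero hdq
          (sub_ne_zero.2 fun h => (Finset.ne_of_mem_erase hk)
            (hw (Finset.mem_of_mem_erase hk) hi h))
          (hH k (Finset.mem_of_mem_erase hk)) (hH0 i hi) (hH0 k (Finset.mem_of_mem_erase hk))
      obtain ⟨B, hB, hB0, hmem⟩ := ih (s.erase i) (by rw [Finset.card_erase_of_mem hi, hs]; rfl)
        (hw.mono (Finset.erase_subset i s)) H' hH's hH'0 j (Finset.mem_erase.2 ⟨hij.symm, hj⟩)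
      refine ⟨B, hB, hB0, derivModule_le hf ?_ hmem⟩
      have hL : (fun z => ∑ k ∈ s.erase i, H' k z * Complex.exp (w k * z ^ q))
          = H i * deriv f
            + -(deriv (H i) + (fun _ => w i) * (fun z : ℂ => (q : ℂ) * z ^ (q - 1)) * H i) * f := by
        ext z
        have h1 : ∑ k ∈ s.erase i, H' k z * Complex.exp (w k * z ^ q)
            = ∑ k ∈ s, H' k z * Complex.exp (w k * z ^ q) := by
          rw [← Finset.add_sum_erase s _ hi]
          simp only [hH'def]
          ring
        rw [h1]
        simp only [Pi.add_apply, Pi.mul_apply, Pi.neg_apply, (hderiv z).deriv]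
        rw [hfdef]
        simp only [Finset.mul_sum, ← Finset.sum_add_distrib]
        refine Finset.sum_congr rfl fun k _ => ?_
        simp only [hH'def]
        ring
      rw [hL]
      refine add_mem (hHi.mul_mem_derivModule
        (deriv_mem_derivModule hf (self_mem_derivModule d f)).2) ?_
      exact (hHi.deriv.add (((SmallGrowth.const (w i)).mul hpow).mul hHi)).neg.mul_mem_derivModule
        (self_mem_derivModule d f)
    · push Not at hij
      obtain rfl : s = {j} := Finset.eq_singleton_iff_unique_mem.2 ⟨hj, hij⟩
      refine ⟨H j, hH j hj, hH0 j hj, ?_⟩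
      convert self_mem_derivModule d _ using 1
      ext z
      simp

/-! ### Means over discs. -/

lemma integral_circleMap_eq (u : ℂ → ℝ) (c : ℂ) (r a : ℝ) :
    ∫ θ in a..a + 2 * π, u (circleMap c r θ) = 2 * π * circleAverage u c r := by
  have hper : Function.Periodic (fun θ => u (circleMap c r θ)) (2 * π) := fun θ => by
    simp only [periodic_circleMap c r θ]
  rw [hper.intervalIntegral_add_eq a 0, zero_add, circleAverage, smul_eq_mul, ← mul_assoc,
    mul_inv_cancel₀ (by positivity), one_mul]

/-- Integration over a disc in polar coordinates. -/
lemma integral_closedBall_eq {u : ℂ → ℝ} (hu : Continuous u) (c : ℂ) {ρ : ℝ} (hρ : 0 ≤ ρ) :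
    ∫ w in closedBall c ρ, u w = ∫ t in (0 : ℝ)..ρ, t * (2 * π * circleAverage u c t) := by
  have h1 : ∫ w in closedBall c ρ, u w
      = ∫ w, (closedBall (0 : ℂ) ρ).indicator (fun w => u (c + w)) w := by
    rw [← integral_indicator measurableSet_closedBall,
      ← integral_add_left_eq_self (fun w => (closedBall c ρ).indicator u w) c]
    refine integral_congr_ae (.of_forall fun w => ?_)
    simp [Set.indicator]
  have h2 : ∫ w, (closedBall (0 : ℂ) ρ).indicator (fun w => u (c + w)) w
      = ∫ p in Set.Ioc 0 ρ ×ˢ Set.Ioo (-π) π, p.1 * u (circleMap c p.1 p.2) := by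
    rw [← Complex.integral_comp_polarCoord_symm]
    have hm : MeasurableSet (Set.Ioc 0 ρ ×ˢ Set.Ioo (-π) π) :=
      measurableSet_Ioc.prod measurableSet_Ioo
    have hs : Set.Ioc 0 ρ ×ˢ Set.Ioo (-π) π ⊆ polarCoord.target := by
      rw [polarCoord_target]
      exact Set.prod_mono Set.Ioc_subset_Ioi_self subset_rfl
    rw [← integral_indicator polarCoord.open_target.measurableSet, ← integral_indicator hm]
    congr 1
    ext p
    by_cases hp : p ∈ polarCoord.target
    · have hp' := hp
      rw [polarCoord_target, Set.mem_prod] at hp'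
      have hnorm : ‖Complex.polarCoord.symm p‖ = p.1 := by
        rw [Complex.norm_polarCoord_symm, abs_of_pos hp'.1]
      have hval : c + Complex.polarCoord.symm p = circleMap c p.1 p.2 := by
        rw [Complex.polarCoord_symm_apply, circleMap, Complex.exp_mul_I]
        push_cast
        ring
      rw [Set.indicator_of_mem hp]
      by_cases hpρ : p.1 ≤ ρ
      · rw [Set.indicator_of_mem (show _ ∈ closedBall (0 : ℂ) ρ by
            rw [mem_closedBall_zero_iff, hnorm]; exact hpρ),
          Set.indicator_of_mem (show p ∈ Set.Ioc 0 ρ ×ˢ Set.Ioo (-π) π from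
            ⟨⟨hp'.1, hpρ⟩, hp'.2⟩), hval, smul_eq_mul]
      · rw [Set.indicator_of_notMem (show _ ∉ closedBall (0 : ℂ) ρ by
            rw [mem_closedBall_zero_iff, hnorm]; exact hpρ),
          Set.indicator_of_notMem (fun h => hpρ h.1.2), smul_zero]
    · rw [Set.indicator_of_notMem hp, Set.indicator_of_notMem (fun h => hp (hs h))]
  have hcont : Continuous fun p : ℝ × ℝ => p.1 * u (circleMap c p.1 p.2) := by
    unfold circleMap
    fun_prop
  have hint : IntegrableOn (fun p : ℝ × ℝ => p.1 * u (circleMap c p.1 p.2))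
      (Set.Ioc 0 ρ ×ˢ Set.Ioo (-π) π) (volume.prod volume) :=
    (hcont.continuousOn.integrableOn_compact (isCompact_Icc.prod isCompact_Icc)).mono_set
      (Set.prod_mono Set.Ioc_subset_Icc_self Set.Ioo_subset_Icc_self)
  rw [h1, h2, Measure.volume_eq_prod, setIntegral_prod _ hint,
    intervalIntegral.integral_of_le hρ]
  refine setIntegral_congr_fun measurableSet_Ioc fun t _ => ?_
  simp only
  rw [integral_const_mul, ← integral_Ioc_eq_integral_Ioo,
    ← intervalIntegral.integral_of_le (by linarith [pi_pos])]
  have := integral_circleMap_eq u c t (-π)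
  rw [← this]
  congr 2
  ring

lemma le_integral_closedBall {u : ℂ → ℝ} (hu : Continuous u) {c : ℂ}
    (hsub : ∀ R, u c ≤ circleAverage u c R) {ρ : ℝ} (hρ : 0 ≤ ρ) :
    π * ρ ^ 2 * u c ≤ ∫ w in closedBall c ρ, u w := by
  rw [integral_closedBall_eq hu c hρ]
  have h1 : ∫ t in (0 : ℝ)..ρ, t * (2 * π * u c) = π * ρ ^ 2 * u c := by
    rw [intervalIntegral.integral_mul_const, integral_id]
    ring
  rw [← h1]
  have hc : Continuous fun t => circleAverage u c t := hu.circleAverage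
  refine intervalIntegral.integral_mono_on hρ
    (Continuous.intervalIntegrable (by fun_prop) _ _)
    (Continuous.intervalIntegrable (by fun_prop) _ _) fun t ht => ?_
  have := ht.1
  gcongr
  exact hsub t

lemma continuous_integral_closedBall {u : ℂ → ℝ} (hu : Continuous u) (σ : ℝ) :
    Continuous fun z => ∫ w in closedBall z σ, u w := by
  have h1 : ∀ z, ∫ w in closedBall z σ, u w = ∫ w in closedBall (0 : ℂ) σ, u (z + w) := by
    intro z
    rw [← integral_indicator measurableSet_closedBall,
      ← integral_indicator measurableSet_closedBall,
      ← integral_add_left_eq_self (fun w => (closedBall z σ).indicator u w) z]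
    refine integral_congr_ae (.of_forall fun w => ?_)
    simp [Set.indicator]
  simp_rw [h1]
  exact continuous_parametric_integral_of_continuous (by fun_prop) (isCompact_closedBall _ _)

lemma circleAverage_rotate (u : ℂ → ℝ) (w : ℂ) :
    ∫ θ in (0 : ℝ)..2 * π, u (Complex.exp (θ * Complex.I) * w)
      = 2 * π * circleAverage u 0 ‖w‖ := by
  have h1 : ∀ θ : ℝ, u (Complex.exp (θ * Complex.I) * w)
      = (fun φ => u (circleMap 0 ‖w‖ φ)) (θ + w.arg) := by
    intro θ
    simp only [circleMap_zero]
    congr 1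
    conv_lhs => rw [← Complex.norm_mul_exp_arg_mul_I w]
    push_cast
    rw [add_mul, Complex.exp_add]
    ring
  simp_rw [h1]
  rw [intervalIntegral.integral_comp_add_right (fun φ => u (circleMap 0 ‖w‖ φ)), zero_add,
    add_comm (2 * π), integral_circleMap_eq]

/-- Rotating each disc back to the one centred at `r` and exchanging the integrals turns the
integrand into its circle averages about `0`. -/
lemma circleAverage_integral_closedBall {u : ℂ → ℝ} (hu : Continuous u) (r σ : ℝ) :
    circleAverage (fun z => ∫ w in closedBall z σ, u w) 0 r
      = ∫ w in closedBall (r : ℂ) σ, circleAverage u 0 ‖w‖ := by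
  have h1 : ∀ θ : ℝ, ∫ w in closedBall (circleMap 0 r θ) σ, u w
      = ∫ w in closedBall (r : ℂ) σ, u (Complex.exp (θ * Complex.I) * w) := by
    intro θ
    set e : ℂ ≃ₗᵢ[ℝ] ℂ := rotation (Circle.exp θ) with he
    have he' : ∀ w, e w = Complex.exp (θ * Complex.I) * w := fun w => by
      rw [he, rotation_apply, Circle.coe_exp]
    have h2 := e.measurePreserving.setIntegral_preimage_emb
      e.toHomeomorph.measurableEmbedding u (closedBall (circleMap 0 r θ) σ)
    rw [← h2]
    have h3 : e ⁻¹' closedBall (circleMap 0 r θ) σ = closedBall (r : ℂ) σ := by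
      have : circleMap 0 r θ = e r := by rw [he', circleMap_zero, mul_comm]
      rw [this]
      ext w
      simp
    rw [h3]
    simp_rw [he']
  have h4 : ∀ w : ℂ, circleAverage u 0 ‖w‖
      = (2 * π)⁻¹ * ∫ θ in (0 : ℝ)..2 * π, u (Complex.exp (θ * Complex.I) * w) := by
    intro w
    rw [circleAverage_rotate, ← mul_assoc, inv_mul_cancel₀ (by positivity), one_mul]
  unfold circleAverage at h4 ⊢
  simp_rw [h1]
  simp_rw [h4]
  rw [integral_const_mul, smul_eq_mul, intervalIntegral.integral_of_le (by positivity)]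
  simp_rw [intervalIntegral.integral_of_le (show (0 : ℝ) ≤ 2 * π by positivity)]
  rw [integral_integral_swap]
  have hcont : Continuous fun p : ℝ × ℂ => u (Complex.exp (p.1 * Complex.I) * p.2) := by fun_prop
  rw [Measure.prod_restrict]
  exact (hcont.continuousOn.integrableOn_compact
    (isCompact_Icc.prod (isCompact_closedBall _ _))).mono_set
      (Set.prod_mono Set.Ioc_subset_Icc_self subset_rfl)

lemma circleAverage_integral_closedBall_posLog_le {f : ℂ → ℂ} (hf : Differentiable ℂ f)
    {r σ : ℝ} (hσ : 0 ≤ σ) (hσr : σ < r) :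
    circleAverage (fun z => ∫ w in closedBall z σ, log⁺ ‖f w‖) 0 r
      ≤ π * σ ^ 2 * circleAverage (fun z => log⁺ ‖f z‖) 0 (r + σ) := by
  have hu := continuous_posLog_norm hf.continuous
  rw [circleAverage_integral_closedBall hu]
  have hvol : (volume : Measure ℂ).real (closedBall (r : ℂ) σ) = π * σ ^ 2 := by
    rw [Measure.real, Complex.volume_closedBall]
    rw [ENNReal.toReal_mul, ENNReal.toReal_pow, ENNReal.toReal_ofReal hσ, mul_comm]
    rfl
  rw [← hvol, ← smul_eq_mul, ← setIntegral_const]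
  refine setIntegral_mono_on ?_ ?_ measurableSet_closedBall fun w hw => ?_
  · exact (hu.circleAverage.comp continuous_norm).continuousOn.integrableOn_compact
      (isCompact_closedBall _ _)
  · exact integrableOn_const (measure_closedBall_lt_top).ne
  -- The average of `log⁺ |f|` increases with the radius because it is a Nevanlinna characteristic,
  -- and `‖w‖ ≤ r + σ` on the disc.
  · rw [← characteristic_top_eq_circleAverage hf, ← characteristic_top_eq_circleAverage hf]
    rw [mem_closedBall, dist_eq_norm] at hw
    have h1 : ‖(r : ℂ)‖ = r := by rw [Complex.norm_real, norm_of_nonneg (by linarith)]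
    have h2 : ‖w‖ ≤ r + σ := by
      have := norm_add_le (w - r) (r : ℂ)
      rw [sub_add_cancel, h1] at this
      linarith
    have h3 : r - σ ≤ ‖w‖ := by
      have := norm_sub_norm_le (r : ℂ) w
      rw [norm_sub_rev, h1] at this
      linarith
    exact ValueDistribution.characteristic_monotoneOn hf.meromorphic
      (show 0 < ‖w‖ by linarith) (show 0 < r + σ by linarith) h2

/-! ### The indicator function of the leading coefficients. -/

/-- `max (0, max_{a ∈ W} Re (a u))`. -/
noncomputable def maxRe (W : Finset ℂ) (u : ℂ) : ℝ :=
  (insert 0 W).sup' (Finset.insert_nonempty 0 W) fun a => (a * u).re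

section maxRe

variable {W : Finset ℂ}

lemma maxRe_le_iff {u : ℂ} {t : ℝ} : maxRe W u ≤ t ↔ 0 ≤ t ∧ ∀ a ∈ W, (a * u).re ≤ t := by
  simp [maxRe]

lemma maxRe_nonneg (u : ℂ) : 0 ≤ maxRe W u := (maxRe_le_iff.1 le_rfl).1

lemma re_le_maxRe {a : ℂ} (ha : a ∈ W) (u : ℂ) : (a * u).re ≤ maxRe W u :=
  (maxRe_le_iff.1 le_rfl).2 a ha

lemma continuous_maxRe (W : Finset ℂ) : Continuous (maxRe W) :=
  Continuous.finset_sup'_apply _ fun a _ => by fun_prop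

lemma maxRe_ofReal_mul {t : ℝ} (ht : 0 ≤ t) (u : ℂ) : maxRe W (t * u) = t * maxRe W u := by
  have h : ∀ a : ℂ, (a * (t * u)).re = t * (a * u).re := fun a => by
    rw [mul_left_comm, Complex.re_ofReal_mul]
  refine le_antisymm (maxRe_le_iff.2 ⟨mul_nonneg ht (maxRe_nonneg u), fun a ha => ?_⟩) ?_
  · rw [h]
    gcongr
    exact re_le_maxRe ha u
  · rcases ht.eq_or_lt with rfl | ht
    · simpa using maxRe_nonneg (W := W) 0
    · rw [mul_comm, ← le_div_iff₀ ht, maxRe_le_iff]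
      refine ⟨div_nonneg (maxRe_nonneg _) ht.le, fun a ha => ?_⟩
      rw [le_div_iff₀ ht, mul_comm, ← h]
      exact re_le_maxRe ha _

lemma circleAverage_maxRe_pow {q : ℕ} (hq : q ≠ 0) {r : ℝ} (hr : 0 ≤ r) :
    circleAverage (fun z => maxRe W (z ^ q)) 0 r = r ^ q * circleAverage (maxRe W) 0 1 := by
  rw [circleAverage_comp_pow (continuous_maxRe W) hq,
    circleAverage_of_homogeneous (fun t u ht => maxRe_ofReal_mul ht u) (by positivity)]

end maxRe

/-! ### Upper and lower bounds for the proximity function. -/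

section ExponentialSum

variable {ι : Type*} {d q : ℕ} {s : Finset ι} {w : ι → ℂ} {H : ι → ℂ → ℂ}

lemma differentiable_exponentialSum (hH : ∀ i ∈ s, SmallGrowth d (H i)) :
    Differentiable ℂ fun z => ∑ i ∈ s, H i z * Complex.exp (w i * z ^ q) :=
  Differentiable.fun_sum fun i hi => (hH i hi).1.mul (by fun_prop)

lemma exists_circleAverage_exponentialSum_le (hq : q ≠ 0) (hH : ∀ i ∈ s, SmallGrowth d (H i)) :
    ∃ C : ℝ, 0 ≤ C ∧ ∀ r : ℝ, 0 ≤ r →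
      circleAverage (fun z => log⁺ ‖∑ i ∈ s, H i z * Complex.exp (w i * z ^ q)‖) 0 r
        ≤ r ^ q * circleAverage (maxRe (s.image w)) 0 1 + C * growthScale d r := by
  have h1 : ∀ i ∈ s, ∃ C : ℝ, 0 ≤ C ∧ ∀ z, ‖H i z‖ ≤ exp (C * growthScale d ‖z‖) :=
    fun i hi => (hH i hi).2
  choose! C hC h1 using h1
  have hl2 : 0 < Real.log 2 := Real.log_pos (by norm_num)
  have hS := Finset.sum_nonneg hC
  refine ⟨∑ i ∈ s, C i + log (s.card + 1) / log 2,
    add_nonneg hS (div_nonneg (log_nonneg (by simp)) hl2.le), fun r hr => ?_⟩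
  have hf := differentiable_exponentialSum (q := q) (w := w) hH
  rw [← circleAverage_maxRe_pow hq hr]
  have h2 : ∀ z, ‖z‖ = r → log⁺ ‖∑ i ∈ s, H i z * Complex.exp (w i * z ^ q)‖
      ≤ maxRe (s.image w) (z ^ q)
        + (∑ i ∈ s, C i + log (s.card + 1) / log 2) * growthScale d r := by
    intro z hz
    have hg := growthScale_pos d hr
    have hlog : log (s.card + 1) ≤ log (s.card + 1) / log 2 * growthScale d r := by
      rw [div_mul_eq_mul_div, le_div_iff₀ hl2]
      gcongr
      · exact log_nonneg (by simp)
      · exact log_two_le_growthScale d hr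
    have h3 : 0 ≤ maxRe (s.image w) (z ^ q) := maxRe_nonneg _
    have h4 : 0 ≤ log (s.card + 1 : ℝ) := log_nonneg (by simp)
    have h5 : ‖∑ i ∈ s, H i z * Complex.exp (w i * z ^ q)‖
        ≤ exp (maxRe (s.image w) (z ^ q) + (∑ i ∈ s, C i) * growthScale d r
          + log (s.card + 1)) := by
      rw [exp_add _ (log _), exp_log (by positivity), mul_add, mul_one]
      refine (norm_sum_le _ _).trans (le_trans ?_ (le_add_of_nonneg_right (exp_pos _).le))
      rw [mul_comm, ← nsmul_eq_mul]
      refine Finset.sum_le_card_nsmul _ _ _ fun i hi => ?_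
      rw [norm_mul, Complex.norm_exp, mul_comm, exp_add]
      gcongr
      · exact re_le_maxRe (Finset.mem_image_of_mem w hi) _
      · refine (h1 i hi z).trans ?_
        rw [hz]
        gcongr
        exact Finset.single_le_sum hC hi
    have h6 := posLog_le_of_le_exp (norm_nonneg _) (by positivity) h5
    rw [add_mul]
    linarith
  have h3 : Continuous fun z => maxRe (s.image w) (z ^ q) :=
    (continuous_maxRe _).comp (continuous_pow q)
  have h4 : circleAverage (fun _ => (∑ i ∈ s, C i + log (s.card + 1) / log 2) * growthScale d r)
      (0 : ℂ) r = (∑ i ∈ s, C i + log (s.card + 1) / log 2) * growthScale d r :=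
    circleAverage_const _ _ _
  rw [← h4, ← circleAverage_fun_add (circleIntegrable_of_continuous h3 _ _)
    (circleIntegrable_of_continuous continuous_const _ _)]
  refine circleAverage_mono (circleIntegrable_of_continuous
    (continuous_posLog_norm hf.continuous) _ _)
    (circleIntegrable_of_continuous (by fun_prop) _ _) fun z hz => ?_
  rw [abs_of_nonneg hr, mem_sphere_zero_iff_norm] at hz
  exact h2 z hz

variable [DecidableEq ι]

/-- The product of the individual multipliers serves for all exponentials at once; it is nonzero
because entire functions form an integral domain. -/
lemma exists_common_denominator (hdq : d < q) (hw : Set.InjOn w s)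
    (hH : ∀ i ∈ s, SmallGrowth d (H i)) (hH0 : ∀ i ∈ s, H i ≠ 0) :
    ∃ B, SmallGrowth d B ∧ B ≠ 0 ∧ ∀ j ∈ s, (B * fun z => Complex.exp (w j * z ^ q)) ∈
      derivModule d (fun z => ∑ i ∈ s, H i z * Complex.exp (w i * z ^ q)) := by
  have key : ∀ t ⊆ s, ∃ B, SmallGrowth d B ∧ B ≠ 0 ∧ ∀ j ∈ t,
      (B * fun z => Complex.exp (w j * z ^ q)) ∈
        derivModule d (fun z => ∑ i ∈ s, H i z * Complex.exp (w i * z ^ q)) := by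
    intro t
    induction t using Finset.induction_on with
    | empty => exact fun _ => ⟨1, SmallGrowth.const 1, one_ne_zero, by simp⟩
    | insert k t hk ih =>
      intro ht
      obtain ⟨B, hB, hB0, hBt⟩ := ih ((Finset.subset_insert k t).trans ht)
      obtain ⟨D, hD, hD0, hDk⟩ := exists_mul_exp_mem_derivModule hdq w _ s rfl hw H hH hH0 k
        (ht (Finset.mem_insert_self k t))
      refine ⟨B * D, hB.mul hD, fun h => ?_, fun j hj => ?_⟩
      · rcases AnalyticOnNhd.eq_zero_or_eq_zero_of_mul_eq_zero (U := Set.univ)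
          (fun z _ => hB.1.analyticAt z) (fun z _ => hD.1.analyticAt z)
          (fun z _ => congrFun h z) isPreconnected_univ with h | h
        · exact hB0 (funext fun z => h z trivial)
        · exact hD0 (funext fun z => h z trivial)
      · rcases Finset.mem_insert.1 hj with rfl | hj
        · rw [mul_assoc]
          exact hB.mul_mem_derivModule hDk
        · rw [mul_comm B, mul_assoc]
          exact hD.mul_mem_derivModule (hBt j hj)
  exact key s subset_rfl

/-- Cauchy's estimate for the members `B e^(w_j z^q)` of `derivModule`, after taking logarithms.
Each derivative costs a factor `δ⁻¹`, hence the term `N * log δ⁻¹`. -/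
lemma exists_maxRe_le (hdq : d < q) (hw : Set.InjOn w s)
    (hH : ∀ i ∈ s, SmallGrowth d (H i)) (hH0 : ∀ i ∈ s, H i ≠ 0) :
    ∃ B, SmallGrowth d B ∧ B ≠ 0 ∧ ∃ N C : ℝ, 0 ≤ N ∧ 0 ≤ C ∧ ∀ (z : ℂ) (δ A : ℝ), B z ≠ 0 →
      0 < δ → δ ≤ 1 → 0 ≤ A →
      (∀ ζ ∈ closedBall z δ, log⁺ ‖∑ i ∈ s, H i ζ * Complex.exp (w i * ζ ^ q)‖ ≤ A) →
        maxRe (s.image w) (z ^ q)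
          ≤ A + C * growthScale d ‖z‖ + N * log δ⁻¹ + log⁺ ‖(B z)⁻¹‖ := by
  obtain ⟨B, hB, hB0, hmem⟩ := exists_common_denominator hdq hw hH hH0
  have hf := differentiable_exponentialSum (q := q) (w := w) hH
  have h1 := fun j hj => exists_norm_le_of_mem_derivModule hf (hmem j hj)
  choose! N C hC h1 using h1
  refine ⟨B, hB, hB0, ∑ j ∈ s, (N j : ℝ), ∑ j ∈ s, C j, by positivity,
    Finset.sum_nonneg hC, fun z δ A hBz hδ hδ1 hA h => ?_⟩
  have hg0 := (growthScale_pos d (norm_nonneg z)).le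
  have hlog : 0 ≤ log δ⁻¹ := log_nonneg (one_le_inv_iff₀.2 ⟨hδ, hδ1⟩)
  have hN : ∀ j ∈ s, (N j : ℝ) ≤ ∑ j ∈ s, (N j : ℝ) := fun j hj =>
    Finset.single_le_sum (f := fun j => (N j : ℝ)) (fun _ _ => by positivity) hj
  have hC' : ∀ j ∈ s, C j ≤ ∑ j ∈ s, C j := fun j hj => Finset.single_le_sum hC hj
  have hpos : 0 ≤ log⁺ ‖(B z)⁻¹‖ := posLog_nonneg
  rw [maxRe_le_iff]
  refine ⟨by have := Finset.sum_nonneg hC; positivity, ?_⟩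
  rw [Finset.forall_mem_image]
  intro j hj
  have h2 := h1 j hj z δ (exp A) hδ hδ1 fun ζ hζ => by
    rcases eq_or_ne (∑ i ∈ s, H i ζ * Complex.exp (w i * ζ ^ q)) 0 with h0 | h0
    · rw [h0, norm_zero]; positivity
    · rw [← log_le_iff_le_exp (norm_pos_iff.2 h0)]
      refine le_trans ?_ (h ζ hζ)
      rw [posLog_apply]; exact le_max_right _ _
  simp only [Pi.mul_apply, norm_mul, Complex.norm_exp] at h2
  have hBpos : 0 < ‖B z‖ := norm_pos_iff.2 hBz
  have h3 := log_le_log (by positivity) h2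
  rw [log_mul hBpos.ne' (exp_pos _).ne', log_exp, log_mul (exp_pos _).ne' (by positivity), log_exp,
    log_mul (by positivity) (exp_pos _).ne', log_exp, log_pow] at h3
  have h4 : -log ‖B z‖ ≤ log⁺ ‖(B z)⁻¹‖ := by
    rw [posLog_apply, norm_inv, log_inv]; exact le_max_right _ _
  have h5 := mul_le_mul_of_nonneg_right (hN j hj) hlog
  have h6 := mul_le_mul_of_nonneg_right (hC' j hj) hg0
  linarith

lemma exists_circleAverage_maxRe_le (hdq : d < q) (hw : Set.InjOn w s)
    (hH : ∀ i ∈ s, SmallGrowth d (H i)) (hH0 : ∀ i ∈ s, H i ≠ 0) :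
    ∃ N C : ℝ, 0 ≤ N ∧ 0 ≤ C ∧ ∀ r δ σ : ℝ, 1 ≤ r → 0 < δ → δ ≤ 1 → δ < σ → σ < r →
      r ^ q * circleAverage (maxRe (s.image w)) 0 1
        ≤ (σ / (σ - δ)) ^ 2 * circleAverage
            (fun z => log⁺ ‖∑ i ∈ s, H i z * Complex.exp (w i * z ^ q)‖) 0 (r + σ)
          + C * growthScale d r + N * log δ⁻¹ := by
  obtain ⟨B, hB, hB0, N, C, hN, hC, h⟩ := exists_maxRe_le hdq hw hH hH0
  obtain ⟨D, hD, hBD⟩ := hB.circleAverage_posLog_inv_le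
  refine ⟨N, C + D, hN, by positivity, fun r δ σ hr hδ hδ1 hδσ hσr => ?_⟩
  have hf := differentiable_exponentialSum (q := q) (w := w) hH
  set f : ℂ → ℂ := fun z => ∑ i ∈ s, H i z * Complex.exp (w i * z ^ q)
  set u : ℂ → ℝ := fun z => log⁺ ‖f z‖ with hu_def
  have hu : Continuous u := continuous_posLog_norm hf.continuous
  have hr0 : 0 ≤ r := by linarith
  have hρ : 0 < σ - δ := by linarith
  have hK : 0 < (π * (σ - δ) ^ 2)⁻¹ := by positivity
  -- The disc of radius `σ - δ` about any `ζ` within `δ` of `z` lies in the disc of radius `σ` about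
  -- `z`, so the sub-mean value property at `ζ` gives one bound for all such `ζ`.
  have hA : ∀ z, ∀ ζ ∈ closedBall z δ,
      u ζ ≤ (π * (σ - δ) ^ 2)⁻¹ * ∫ x in closedBall z σ, u x := by
    intro z ζ hζ
    have h1 := le_integral_closedBall hu (fun R => posLog_norm_le_circleAverage hf ζ R) hρ.le
    have h2 : ∫ x in closedBall ζ (σ - δ), u x ≤ ∫ x in closedBall z σ, u x := by
      refine setIntegral_mono_set
        (hu.continuousOn.integrableOn_compact (isCompact_closedBall _ _))
        (.of_forall fun x => posLog_nonneg) (LE.le.eventuallyLE ?_)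
      refine closedBall_subset_closedBall' ?_
      rw [mem_closedBall] at hζ
      linarith
    rw [inv_mul_eq_div, le_div_iff₀ (by positivity), mul_comm]
    exact h1.trans h2
  set c := C * growthScale d r + N * log δ⁻¹
  have hcont := continuous_integral_closedBall hu σ
  have h1 := circleAverage_le_add_of_le_posLog_inv (r := r)
    (h₁ := fun z => maxRe (s.image w) (z ^ q))
    (h₂ := fun z => (π * (σ - δ) ^ 2)⁻¹ * (∫ x in closedBall z σ, u x) + c)
    ((continuous_maxRe _).comp (continuous_pow q)) (by fun_prop) hB.1 hB0 (by linarith)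
    fun z hz hBz => by
      rw [abs_of_nonneg hr0, mem_sphere_zero_iff_norm] at hz
      have := h z δ ((π * (σ - δ) ^ 2)⁻¹ * ∫ x in closedBall z σ, u x) hBz hδ hδ1
        (mul_nonneg hK.le (integral_nonneg fun x => posLog_nonneg)) (hA z)
      rw [hz] at this
      simp only [c]
      linarith
  rw [circleAverage_maxRe_pow (by omega) hr0, circleAverage_fun_add
    (circleIntegrable_of_continuous (by fun_prop) _ _)
    (circleIntegrable_of_continuous (by fun_prop) _ _), circleAverage_const] at h1
  have h2 : circleAverage (fun z => (π * (σ - δ) ^ 2)⁻¹ * ∫ x in closedBall z σ, u x) 0 r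
      = (π * (σ - δ) ^ 2)⁻¹ * circleAverage (fun z => ∫ x in closedBall z σ, u x) 0 r :=
    circleAverage_fun_smul (𝕜 := ℝ) (a := (π * (σ - δ) ^ 2)⁻¹)
      (f := fun z => ∫ x in closedBall z σ, u x)
  have h3 := circleAverage_integral_closedBall_posLog_le hf (r := r) (σ := σ) (by linarith) hσr
  have h4 := mul_le_mul_of_nonneg_left h3 hK.le
  have h5 : ∀ T : ℝ, (π * (σ - δ) ^ 2)⁻¹ * (π * σ ^ 2 * T) = (σ / (σ - δ)) ^ 2 * T := by
    intro T
    have := pi_pos.ne'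
    have := hρ.ne'
    field_simp
  rw [h5] at h4
  have h6 := hBD r hr
  rw [h2] at h1
  simp only [c] at h1
  linarith

/-- The asymptotic formula for the proximity function of `∑ Hᵢ e ^ (wᵢ z ^ q)`. -/
theorem exists_abs_circleAverage_sub_le {p : ℕ} (hp : 1 ≤ p) (hq : d + p = q)
    (hw : Set.InjOn w s) (hH : ∀ i ∈ s, SmallGrowth d (H i)) (hH0 : ∀ i ∈ s, H i ≠ 0) :
    ∃ C : ℝ, ∀ R : ℝ, 4 ≤ R →
      |circleAverage (fun z => log⁺ ‖∑ i ∈ s, H i z * Complex.exp (w i * z ^ q)‖) 0 R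
        - R ^ q * circleAverage (maxRe (s.image w)) 0 1| ≤ C * growthScale d R := by
  obtain ⟨C₁, hC₁, hup⟩ := exists_circleAverage_exponentialSum_le (s := s) (w := w) (H := H)
    (by omega : q ≠ 0) hH
  obtain ⟨N, C₂, hN, hC₂, hlow⟩ := exists_circleAverage_maxRe_le (by omega : d < q) hw hH hH0
  set T : ℝ → ℝ :=
    circleAverage (fun z => log⁺ ‖∑ i ∈ s, H i z * Complex.exp (w i * z ^ q)‖) 0 with hT
  set κ := circleAverage (maxRe (s.image w)) 0 1
  have hκ : 0 ≤ κ := circleAverage_nonneg_of_nonneg fun z _ => maxRe_nonneg z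
  refine ⟨q * κ + 6 * (κ + C₁) + C₁ + C₂ + N * (2 * p), fun R hR => ?_⟩
  have hR0 : 0 < R := by linarith
  have hψ := (growthScale_pos d hR0.le)
  have hlogR : log R ≤ growthScale d R := by
    have h1 : log R ≤ log (R + 2) := log_le_log hR0 (by linarith)
    have h2 : 0 ≤ R ^ d := by positivity
    unfold growthScale; linarith
  have hRd : R ^ d ≤ growthScale d R := by
    have h1 : 0 ≤ log (R + 2) := log_nonneg (by linarith)
    unfold growthScale; linarith
  have hlog0 : 0 ≤ log R := log_nonneg (by linarith)
  set x := (R ^ p)⁻¹ with hx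
  have hRp : R ≤ R ^ p := le_self_pow₀ (by linarith) (by omega)
  have hx0 : 0 < x := by positivity
  have hxhalf : x ≤ 1 / 4 := by
    rw [hx, inv_le_comm₀ (by positivity) (by norm_num)]
    norm_num
    linarith
  have hRx : R * x ≤ 1 := by
    rw [hx, ← div_eq_mul_inv, div_le_one (by positivity)]
    exact hRp
  have hxq : x * R ^ q = R ^ d := by
    rw [← hq, pow_add, hx]
    field_simp
  have hTR : T R ≤ R ^ q * κ + C₁ * growthScale d R := hup R hR0.le
  have hT0 : 0 ≤ T R := circleAverage_nonneg_of_nonneg fun z _ => posLog_nonneg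
  -- The choice is `σ = R x`, `δ = R x²`, `r = R - σ` with `x = R^(-p)`. The area ratio is `(1 -
  -- x)⁻² ≤ 1 + 6x`, and `x T(R)` is of the order of the scale because `x R^q = R^d`. Likewise `R^q
  -- - r^q ≤ q R^d`, and `log δ⁻¹ ≤ 2p log R`.
  have h1 := hlow (R - R * x) (R * x * x) (R * x) (by nlinarith) (by positivity)
    (by nlinarith) (by nlinarith [mul_pos hR0 hx0]) (by nlinarith)
  rw [sub_add_cancel] at h1
  have h2 : R * x / (R * x - R * x * x) = (1 - x)⁻¹ := by
    have : R * x ≠ 0 := by positivity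
    rw [← mul_one_sub, div_mul_eq_div_div, div_self this, one_div]
  have h3 : ((1 - x)⁻¹) ^ 2 ≤ 1 + 6 * x := by
    rw [inv_pow, inv_le_iff_one_le_mul₀ (by nlinarith)]
    nlinarith [mul_nonneg hx0.le hx0.le, mul_nonneg (mul_nonneg hx0.le hx0.le) hx0.le,
      mul_nonneg hx0.le (by linarith : 0 ≤ 1 / 4 - x)]
  have h4 : log (R * x * x)⁻¹ ≤ 2 * p * log R := by
    rw [hx, log_inv, log_mul (by positivity) (by positivity), log_mul (by positivity) (by positivity),
      log_inv, log_pow]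
    linarith
  have h5 : R ^ q * (1 - q * x) ≤ (R - R * x) ^ q := by
    rw [← mul_one_sub, mul_pow]
    gcongr
    have := one_add_mul_le_pow (a := -x) (by linarith) q
    rw [← sub_eq_add_neg] at this
    linarith
  have h6 : growthScale d (R - R * x) ≤ growthScale d R :=
    growthScale_mono d (by nlinarith) (by nlinarith)
  rw [h2] at h1
  have h7 : (R ^ q - q * R ^ d) * κ ≤ (R - R * x) ^ q * κ := by
    rw [← hxq]
    refine mul_le_mul_of_nonneg_right ?_ hκ
    linarith
  have h8 : ((1 - x)⁻¹) ^ 2 * T R ≤ T R + 6 * (x * T R) := by nlinarith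
  have h9 : x * T R ≤ (κ + C₁) * growthScale d R := by
    have e1 : x * T R ≤ x * (R ^ q * κ + C₁ * growthScale d R) := by gcongr
    have e2 : x * (R ^ q * κ + C₁ * growthScale d R)
        = R ^ d * κ + x * (C₁ * growthScale d R) := by rw [← hxq]; ring
    have e3 : R ^ d * κ ≤ growthScale d R * κ := by gcongr
    have e4 : x * (C₁ * growthScale d R) ≤ 1 * (C₁ * growthScale d R) := by
      gcongr; linarith
    linarith
  have h10 : C₂ * growthScale d (R - R * x) ≤ C₂ * growthScale d R := by gcongr
  have h11 : N * log (R * x * x)⁻¹ ≤ N * (2 * p) * growthScale d R := by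
    rw [mul_assoc N]
    exact mul_le_mul_of_nonneg_left (h4.trans (by gcongr)) hN
  have h12 : q * R ^ d * κ ≤ q * κ * growthScale d R := by
    rw [mul_right_comm]
    gcongr
  have h13 : 0 ≤ q * κ * growthScale d R := by positivity
  have h14 : 0 ≤ (κ + C₁) * growthScale d R := by positivity
  have h15 : 0 ≤ C₂ * growthScale d R := by positivity
  have h16 : 0 ≤ N * (2 * p) * growthScale d R := by positivity
  have h17 : 0 ≤ C₁ * growthScale d R := by positivity
  have h18 : R ^ q * κ - q * R ^ d * κ ≤ T R + 6 * (x * T R) + C₂ * growthScale d (R - R * x)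
      + N * log (R * x * x)⁻¹ := by
    rw [← sub_mul]
    linarith
  have h19 : (q * κ + 6 * (κ + C₁) + C₁ + C₂ + N * (2 * p)) * growthScale d R
      = q * κ * growthScale d R + 6 * ((κ + C₁) * growthScale d R) + C₁ * growthScale d R
        + C₂ * growthScale d R + N * (2 * p) * growthScale d R := by ring
  rw [abs_le, h19]
  constructor <;> linarith

end ExponentialSum

/-! ### From order of growth to small growth for exponential polynomials. -/

lemma norm_le_maxModulus {g : ℂ → ℂ} (hg : Continuous g) (z : ℂ) : ‖g z‖ ≤ maxModulus g ‖z‖ :=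
  le_csSup ((isCompact_sphere (0 : ℂ) ‖z‖).image hg.norm).bddAbove
    ⟨z, mem_sphere_zero_iff_norm.2 rfl, rfl⟩

lemma eventually_posLog_norm_le_rpow {g : ℂ → ℂ} (hg : Continuous g) {d : ℕ}
    (h : growthOrder g ≤ ((d : ℕ) : EReal)) :
    ∀ᶠ r : ℝ in atTop, ∀ z : ℂ, ‖z‖ = r → log⁺ ‖g z‖ ≤ r ^ ((d : ℝ) + 1 / 2) := by
  -- Any exponent strictly between `d` and `d + 1` would do: it must exceed the order, yet stay
  -- below `D + 1` when `d ≤ D`.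
  have h1 : growthOrder g < (((d : ℝ) + 1 / 2 : ℝ) : EReal) := by
    refine h.trans_lt ?_
    rw [← EReal.coe_coe_eq_natCast, EReal.coe_lt_coe_iff]
    linarith
  filter_upwards [eventually_lt_of_limsup_lt h1, eventually_gt_atTop 1] with r hr hr1 z hz
  rw [EReal.coe_lt_coe_iff, div_lt_iff₀ (log_pos hr1)] at hr
  have h2 : log⁺ ‖g z‖ ≤ log⁺ (maxModulus g r) :=
    posLog_le_posLog (norm_nonneg _) (by rw [← hz]; exact norm_le_maxModulus hg z)
  refine h2.trans ?_
  rw [rpow_def_of_pos (by linarith), mul_comm]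
  rcases (posLog_nonneg (x := maxModulus g r)).eq_or_lt with h0 | h0
  · rw [← h0]; positivity
  · rw [← log_le_iff_le_exp h0]
    refine le_trans ?_ hr.le
    exact (le_max_right _ _).trans_eq posLog_apply.symm

lemma circleAverage_maxRe_pos {W : Finset ℂ} {a : ℂ} (ha : a ∈ W) (ha0 : a ≠ 0) :
    0 < circleAverage (maxRe W) 0 1 := by
  have h1 : circleAverage (fun z => max (a * z).re 0) 0 1 ≤ circleAverage (maxRe W) 0 1 :=
    circleAverage_mono (circleIntegrable_of_continuous (by fun_prop) _ _)
      (circleIntegrable_of_continuous (continuous_maxRe W) _ _)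
      fun z _ => max_le (re_le_maxRe ha z) (maxRe_nonneg z)
  rw [circleAverage_max_re_mul_zero] at h1
  exact (div_pos (norm_pos_iff.2 ha0) pi_pos).trans_le h1

/-- If a combination of exponentials `e ^ (a z ^ (D + 1))` grows more slowly than the exponentials
do, then only `a = 0` occurs in it. -/
lemma eq_zero_of_growthOrder_le {d D : ℕ} (hdD : d ≤ D) {s : Finset ℂ} {G : ℂ → ℂ → ℂ}
    (hG : ∀ a ∈ s, SmallGrowth D (G a)) (hG0 : ∀ a ∈ s, G a ≠ 0)
    (h : growthOrder (fun z => ∑ a ∈ s, G a z * Complex.exp (a * z ^ (D + 1)))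
      ≤ ((d : ℕ) : EReal)) {a : ℂ} (ha : a ∈ s) : a = 0 := by
  classical
  by_contra ha0
  -- The asymptotic formula with `p = 1` and `q = D + 1`: a nonzero `a` would force the mean of
  -- `log⁺` to grow like `κ r^(D+1)` with `κ > 0`.
  obtain ⟨C, hC⟩ := exists_abs_circleAverage_sub_le (w := fun a : ℂ => a) le_rfl rfl
    (fun _ _ _ _ h => h) hG hG0
  rw [Finset.image_id'] at hC
  have hf := differentiable_exponentialSum (w := fun a : ℂ => a) (q := D + 1) hG
  have hκ := circleAverage_maxRe_pos ha ha0
  set κ := circleAverage (maxRe s) 0 1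
  have h1 := eventually_posLog_norm_le_rpow hf.continuous h
  have h2 := eventually_mul_growthScale_lt (Nat.lt_succ_self D) C (half_pos hκ)
  have h3 : ∀ᶠ r : ℝ in atTop, 2 / κ < r ^ (1 / 2 : ℝ) :=
    (tendsto_rpow_atTop (by norm_num : (0 : ℝ) < 1 / 2)).eventually_gt_atTop _
  obtain ⟨r, h1, h2, h3, hr⟩ := (h1.and (h2.and (h3.and (eventually_ge_atTop 4)))).exists
  have hr0 : 0 < r := by linarith
  have h4 := circleAverage_posLog_norm_le hf.continuous (r := r) fun z hz =>
    h1 z (by rw [hz, abs_of_pos hr0])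
  have h5 := (abs_le.1 (hC r hr)).1
  have h6 : r ^ ((d : ℝ) + 1 / 2) * r ^ (1 / 2 : ℝ) ≤ r ^ (D + 1) := by
    rw [← rpow_add hr0, ← rpow_natCast]
    refine rpow_le_rpow_of_exponent_le (by linarith) ?_
    have : (d : ℝ) ≤ D := by exact_mod_cast hdD
    push_cast
    linarith
  have h7 : 0 < r ^ ((d : ℝ) + 1 / 2) := rpow_pos_of_pos hr0 _
  have h8 : r ^ ((d : ℝ) + 1 / 2) * (2 / κ) < r ^ (D + 1) :=
    (mul_lt_mul_of_pos_left h3 h7).trans_le h6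
  rw [mul_div_assoc', div_lt_iff₀ hκ] at h8
  have h9 : (D + 1 : ℕ) = D.succ := rfl
  rw [← h9] at h2
  linarith

/-- An exponential polynomial of order at most `d` has small growth of exponent `d`. -/
theorem IsExponentialPolynomial.smallGrowth {g : ℂ → ℂ} (hg : IsExponentialPolynomial g) {d : ℕ}
    (h : growthOrder g ≤ ((d : ℕ) : EReal)) : SmallGrowth d g := by
  classical
  obtain ⟨n, P, Q, hPQ⟩ := hg
  obtain ⟨D, hD⟩ : ∃ D, ∀ i, (Q i).natDegree ≤ D :=
    ⟨Finset.univ.sup fun i => (Q i).natDegree,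
      fun i => Finset.le_sup (f := fun i => (Q i).natDegree) (Finset.mem_univ i)⟩
  have small : ∀ (E : ℕ) (t : Finset (Fin n)) (R : Fin n → Polynomial ℂ),
      (∀ i ∈ t, (R i).natDegree ≤ E) →
      SmallGrowth E (fun z => ∑ i ∈ t, (P i).eval z * Complex.exp ((R i).eval z)) :=
    fun E t R hR => SmallGrowth.sum (g := fun i z => (P i).eval z * Complex.exp ((R i).eval z))
      fun i hi => (SmallGrowth.polynomial_eval (P i)).mul
        (SmallGrowth.exp_polynomial_eval (hR i hi))
  obtain rfl : g = fun z => ∑ i, (P i).eval z * Complex.exp ((Q i).eval z) := funext hPQ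
  clear hPQ
  -- Induction on a bound for the degrees of the `Q i`. If this bound `D + 1` exceeds `d`, the terms
  -- are grouped by their coefficient of `z^(D+1)`; the groups have growth exponent `D` by degree
  -- alone, so there is no circularity. By `eq_zero_of_growthOrder_le` only the group with
  -- coefficient `0` survives, and its degrees are at most `D`.
  suffices key : ∀ (D : ℕ) (t : Finset (Fin n)), (∀ i ∈ t, (Q i).natDegree ≤ D) →
      growthOrder (fun z => ∑ i ∈ t, (P i).eval z * Complex.exp ((Q i).eval z))
        ≤ ((d : ℕ) : EReal) →
      SmallGrowth d (fun z => ∑ i ∈ t, (P i).eval z * Complex.exp ((Q i).eval z)) from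
    key D Finset.univ (fun i _ => hD i) h
  clear hD h D
  intro D
  induction D with
  | zero => exact fun t ht _ => small d t Q fun i hi => (ht i hi).trans (Nat.zero_le d)
  | succ D ih =>
    intro t ht h
    rcases lt_or_ge D d with hDd | hdD
    · exact small d t Q fun i hi => (ht i hi).trans hDd
    set c : Fin n → ℂ := fun i => (Q i).coeff (D + 1)
    set R : Fin n → Polynomial ℂ := fun i =>
      Q i - Polynomial.C (c i) * Polynomial.X ^ (D + 1) with hR_def
    set G : ℂ → ℂ → ℂ := fun a z =>
      ∑ i ∈ t with c i = a, (P i).eval z * Complex.exp ((R i).eval z) with hG_def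
    have hR : ∀ i ∈ t, (R i).natDegree ≤ D := by
      intro i hi
      rw [Polynomial.natDegree_le_iff_coeff_eq_zero]
      intro N hN
      rw [hR_def]
      simp only [Polynomial.coeff_sub, Polynomial.coeff_C_mul, Polynomial.coeff_X_pow]
      rcases (Nat.succ_le_of_lt hN).eq_or_lt with h' | h'
      · simp [c, ← h']
      · rw [Polynomial.coeff_eq_zero_of_natDegree_lt ((ht i hi).trans_lt h'),
          if_neg h'.ne']
        simp
    have hG : ∀ a, SmallGrowth D (G a) := fun a =>
      small D _ R fun i hi => hR i (Finset.mem_filter.1 hi).1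
    have hexp : ∀ i z, Complex.exp ((Q i).eval z)
        = Complex.exp ((R i).eval z) * Complex.exp (c i * z ^ (D + 1)) := by
      intro i z
      rw [← Complex.exp_add]
      simp [hR_def]
    have hsum : (fun z => ∑ i ∈ t, (P i).eval z * Complex.exp ((Q i).eval z))
        = fun z => ∑ a ∈ (t.image c).filter (fun a => G a ≠ 0),
            G a z * Complex.exp (a * z ^ (D + 1)) := by
      ext z
      have h1 : ∀ a ∈ t.image c, G a z * Complex.exp (a * z ^ (D + 1)) ≠ 0 → G a ≠ 0 :=
        fun a _ hne h0 => hne (by rw [h0, Pi.zero_apply, zero_mul])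
      rw [Finset.sum_filter_of_ne h1, ← Finset.sum_fiberwise_of_maps_to (g := c) (t := t.image c)
          (fun i hi => Finset.mem_image_of_mem c hi)]
      refine Finset.sum_congr rfl fun a _ => ?_
      rw [hG_def, Finset.sum_mul]
      refine Finset.sum_congr rfl fun i hi => ?_
      rw [hexp, (Finset.mem_filter.1 hi).2, mul_assoc]
    have hzero : ∀ a ∈ (t.image c).filter (fun a => G a ≠ 0), a = 0 := fun a ha =>
      eq_zero_of_growthOrder_le hdD (fun a _ => hG a)
        (fun a ha => (Finset.mem_filter.1 ha).2) (hsum ▸ h) ha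
    have hred : (fun z => ∑ i ∈ t, (P i).eval z * Complex.exp ((Q i).eval z))
        = fun z => ∑ i ∈ t with c i = 0, (P i).eval z * Complex.exp ((Q i).eval z) := by
      rw [hsum]
      ext z
      have h1 : ∑ i ∈ t with c i = 0, (P i).eval z * Complex.exp ((Q i).eval z) = G 0 z := by
        rw [hG_def]
        refine Finset.sum_congr rfl fun i hi => ?_
        rw [hexp, (Finset.mem_filter.1 hi).2]
        simp
      rw [h1]
      by_cases h0 : (0 : ℂ) ∈ (t.image c).filter (fun a => G a ≠ 0)
      · rw [Finset.sum_eq_single_of_mem 0 h0 (fun b hb hb0 => absurd (hzero b hb) hb0)]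
        simp
      · rw [Finset.sum_eq_zero fun a ha => absurd (hzero a ha ▸ ha) h0]
        by_cases h2 : (0 : ℂ) ∈ t.image c
        · have : G 0 = 0 := by
            by_contra h3
            exact h0 (Finset.mem_filter.2 ⟨h2, h3⟩)
          rw [this]
          rfl
        · rw [hG_def]
          refine (Finset.sum_eq_zero fun i hi => ?_).symm
          rw [Finset.mem_filter] at hi
          exact absurd (hi.2 ▸ Finset.mem_image_of_mem c hi.1) h2
    rw [hred] at h ⊢
    refine ih _ (fun i hi => ?_) h
    obtain ⟨hi, hc⟩ := Finset.mem_filter.1 hi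
    have := hR i hi
    simpa [hR_def, hc] using this

/-! ### Convex polygons and Cauchy's formula for the circumference. -/

lemma convexHull_extremePoints_convexHull {V : Set ℂ} (hV : V.Finite) :
    convexHull ℝ ((convexHull ℝ V).extremePoints ℝ) = convexHull ℝ V := by
  have h1 := closure_convexHull_extremePoints (hV.isCompact_convexHull ℝ) (convex_convexHull ℝ V)
  rwa [((hV.subset extremePoints_convexHull_subset).isClosed_convexHull ℝ).closure_eq] at h1

lemma finite_extremePoints_convexHull {V : Set ℂ} (hV : V.Finite) :
    ((convexHull ℝ V).extremePoints ℝ).Finite :=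
  hV.subset extremePoints_convexHull_subset

lemma finite_orientedSides {V : Set ℂ} (hV : V.Finite) :
    (orientedSides (convexHull ℝ V)).Finite :=
  ((finite_extremePoints_convexHull hV).prod (finite_extremePoints_convexHull hV)).subset
    fun _ he => ⟨he.1, he.2.1⟩

/-- The map `x ↦ conj x * u` is an orientation-reversing isometry, so the cross product changes sign
in the new coordinates. Left of a side thus becomes below it when the side ascends in the real part.
-/
lemma im_conj_sub_mul_sub {u : ℂ} (hu : Complex.normSq u = 1) (a b x : ℂ) :
    (conj (b - a) * (x - a)).im
      = ((conj b * u).im - (conj a * u).im) * ((conj x * u).re - (conj a * u).re)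
        - ((conj b * u).re - (conj a * u).re) * ((conj x * u).im - (conj a * u).im) := by
  rw [Complex.normSq_apply] at hu
  simp only [map_sub, Complex.mul_re, Complex.mul_im, Complex.sub_re, Complex.sub_im,
    Complex.conj_re, Complex.conj_im]
  linear_combination (-((b.re - a.re) * (x.im - a.im) - (b.im - a.im) * (x.re - a.re))) * hu

lemma convex_leftHalfPlane (a b : ℂ) : Convex ℝ {x : ℂ | 0 ≤ (conj (b - a) * (x - a)).im} := by
  intro x hx y hy s t hs ht hst
  simp only [Set.mem_ofPred_eq] at hx hy ⊢
  have h1 : conj (b - a) * (s • x + t • y - a)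
      = (s : ℂ) * (conj (b - a) * (x - a)) + (t : ℂ) * (conj (b - a) * (y - a)) := by
    have : (s : ℂ) + t = 1 := by exact_mod_cast hst
    rw [Complex.real_smul, Complex.real_smul]
    linear_combination (-(conj (b - a) * a)) * this.symm
  rw [h1, Complex.add_im, Complex.im_ofReal_mul, Complex.im_ofReal_mul]
  positivity

lemma eq_of_conj_mul_eq {u : ℂ} (hu : u ≠ 0) {x y : ℂ} (hre : (conj x * u).re = (conj y * u).re)
    (him : (conj x * u).im = (conj y * u).im) : x = y := by
  have := mul_right_cancel₀ hu (Complex.ext hre him)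
  exact (starRingEnd ℂ).injective this

/-- Among the segments joining a vertex before the line `h = t` to one after it, the one crossing
the line highest (`X` is the crossing height) is a side: a vertex above it would give a higher
crossing. -/
lemma exists_orientedSide_crossing {V : Set ℂ} (hV : V.Finite) {u : ℂ}
    (hu : Complex.normSq u = 1) {t : ℝ}
    (ht : ∀ x ∈ (convexHull ℝ V).extremePoints ℝ, (conj x * u).re ≠ t)
    (hlo : ∃ x ∈ (convexHull ℝ V).extremePoints ℝ, (conj x * u).re < t)
    (hhi : ∃ x ∈ (convexHull ℝ V).extremePoints ℝ, t < (conj x * u).re) :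
    ∃ e ∈ orientedSides (convexHull ℝ V), (conj e.1 * u).re < t ∧ t < (conj e.2 * u).re := by
  set E := (convexHull ℝ V).extremePoints ℝ with hE
  have hEfin : E.Finite := finite_extremePoints_convexHull hV
  set h : ℂ → ℝ := fun x => (conj x * u).re
  set k : ℂ → ℝ := fun x => (conj x * u).im
  set X : ℂ × ℂ → ℝ := fun e => k e.1 + (t - h e.1) * ((k e.2 - k e.1) / (h e.2 - h e.1)) with hX
  obtain ⟨⟨a, b⟩, ⟨⟨haE, ha⟩, ⟨hbE, hb⟩⟩, hmax⟩ := Set.exists_max_image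
    ({x ∈ E | h x < t} ×ˢ {x ∈ E | t < h x}) X
    ((hEfin.subset (Set.sep_subset _ _)).prod (hEfin.subset (Set.sep_subset _ _)))
    (by obtain ⟨x, hx⟩ := hlo; obtain ⟨y, hy⟩ := hhi; exact ⟨(x, y), hx, hy⟩)
  simp only at haE ha hbE hb
  refine ⟨(a, b), ⟨haE, hbE, fun hab => ?_, ?_⟩, ha, hb⟩
  · simp only at hab
    rw [hab] at ha
    exact lt_asymm ha hb
  have hsub : E ⊆ {x : ℂ | 0 ≤ (conj (b - a) * (x - a)).im} := by
    intro x hx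
    rw [Set.mem_ofPred_eq, im_conj_sub_mul_sub hu]
    change 0 ≤ (k b - k a) * (h x - h a) - (h b - h a) * (k x - k a)
    rcases (ht x hx).lt_or_gt with hxt | hxt
    · have h1 := hmax (x, b) ⟨⟨hx, hxt⟩, ⟨hbE, hb⟩⟩
      have hXb : ∀ y, h y < h b → X (y, b) = k b - (h b - t) * ((k b - k y) / (h b - h y)) := by
        intro y hy
        have : h b - h y ≠ 0 := (sub_pos.2 hy).ne'
        simp only [hX]
        field_simp
        ring
      rw [hXb x (hxt.trans hb), hXb a (ha.trans hb)] at h1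
      have h2 : (k b - k a) / (h b - h a) ≤ (k b - k x) / (h b - h x) := by
        refine le_of_mul_le_mul_left ?_ (sub_pos.2 hb)
        linarith
      rw [div_le_div_iff₀ (sub_pos.2 (ha.trans hb)) (sub_pos.2 (hxt.trans hb))] at h2
      linarith
    · have h1 := hmax (a, x) ⟨⟨haE, ha⟩, ⟨hx, hxt⟩⟩
      simp only [hX] at h1
      have h2 : (k x - k a) / (h x - h a) ≤ (k b - k a) / (h b - h a) := by
        refine le_of_mul_le_mul_left ?_ (sub_pos.2 ha)
        linarith
      rw [div_le_div_iff₀ (sub_pos.2 (ha.trans hxt)) (sub_pos.2 (ha.trans hb))] at h2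
      linarith
  intro x hx
  rw [← convexHull_extremePoints_convexHull hV] at hx
  exact convexHull_min hsub (convex_leftHalfPlane a b) hx

lemma notMem_extremePoints_of_collinear {K : Set ℂ} {u a b x : ℂ} (hu : u ≠ 0) (ha : a ∈ K)
    (hb : b ∈ K) {c m : ℝ} (hka : (conj a * u).im = c + m * (conj a * u).re)
    (hkb : (conj b * u).im = c + m * (conj b * u).re)
    (hkx : (conj x * u).im = c + m * (conj x * u).re)
    (hax : (conj a * u).re < (conj x * u).re) (hxb : (conj x * u).re < (conj b * u).re) :
    x ∉ K.extremePoints ℝ := by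
  intro hx
  have hpos : 0 < (conj b * u).re - (conj a * u).re := by linarith
  set s : ℝ := ((conj b * u).re - (conj x * u).re) / ((conj b * u).re - (conj a * u).re) with hs
  set r : ℝ := ((conj x * u).re - (conj a * u).re) / ((conj b * u).re - (conj a * u).re) with hr
  have hs0 : 0 < s := div_pos (by linarith) hpos
  have hr0 : 0 < r := div_pos (by linarith) hpos
  have hsr : s + r = 1 := by 
    rw [hs, hr, ← add_div, div_eq_one_iff_eq hpos.ne']
    ring
  have hexp : conj (s • a + r • b) * u = (s : ℂ) * (conj a * u) + (r : ℂ) * (conj b * u) := by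
    simp only [Complex.real_smul, map_add, map_mul, Complex.conj_ofReal]
    ring
  have hre : (conj (s • a + r • b) * u).re = (conj x * u).re := by
    rw [hexp, Complex.add_re, Complex.re_ofReal_mul, Complex.re_ofReal_mul, hs, hr,
      div_mul_eq_mul_div, div_mul_eq_mul_div, ← add_div, div_eq_iff hpos.ne']
    ring
  have hmem : x ∈ openSegment ℝ a b := by
    refine ⟨s, r, hs0, hr0, hsr, eq_of_conj_mul_eq hu hre ?_⟩
    rw [hkx, ← hre, hexp, Complex.add_im, Complex.add_re, Complex.im_ofReal_mul,
      Complex.im_ofReal_mul, Complex.re_ofReal_mul, Complex.re_ofReal_mul, hka, hkb]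
    linear_combination c * hsr
  have := hx.2 ha hb hmem
  rw [this] at hax
  exact lt_irrefl _ hax

/-- Each of the two lines lies above the endpoints of the other side. Both sides straddle `t`, so
the difference of the lines, an affine function, must vanish. On a common line, distinct endpoints
would put an extreme point strictly between two points of `K`. -/
lemma orientedSide_crossing_unique {K : Set ℂ} {u : ℂ} (hu : Complex.normSq u = 1) {t : ℝ}
    {e e' : ℂ × ℂ} (he : e ∈ orientedSides K) (he' : e' ∈ orientedSides K)
    (h1 : (conj e.1 * u).re < t) (h2 : t < (conj e.2 * u).re)
    (h1' : (conj e'.1 * u).re < t) (h2' : t < (conj e'.2 * u).re) : e = e' := by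
  obtain ⟨a, b⟩ := e
  obtain ⟨a', b'⟩ := e'
  obtain ⟨ha, hb, -, hl⟩ := he
  obtain ⟨ha', hb', -, hl'⟩ := he'
  simp only at *
  have hu0 : u ≠ 0 := by
    rintro rfl
    simp at hu
  have line : ∀ a b : ℂ, (conj a * u).re < (conj b * u).re → ∃ c m : ℝ,
      (conj a * u).im = c + m * (conj a * u).re ∧ (conj b * u).im = c + m * (conj b * u).re ∧
      ∀ x : ℂ, 0 ≤ (conj (b - a) * (x - a)).im → (conj x * u).im ≤ c + m * (conj x * u).re := by
    intro a b hab
    have hpos := sub_pos.2 hab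
    set m := ((conj b * u).im - (conj a * u).im) / ((conj b * u).re - (conj a * u).re)
    have hm : m * ((conj b * u).re - (conj a * u).re) = (conj b * u).im - (conj a * u).im :=
      div_mul_cancel₀ _ hpos.ne'
    refine ⟨(conj a * u).im - m * (conj a * u).re, m, by ring, by linarith, fun x hx => ?_⟩
    rw [im_conj_sub_mul_sub hu, ← hm] at hx
    have : 0 ≤ m * ((conj x * u).re - (conj a * u).re) - ((conj x * u).im - (conj a * u).im) := by
      refine nonneg_of_mul_nonneg_right (b := _) (a := (conj b * u).re - (conj a * u).re) ?_ hpos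
      linarith
    linarith
  obtain ⟨c, m, hka, hkb, hline⟩ := line a b (h1.trans h2)
  obtain ⟨c', m', hka', hkb', hline'⟩ := line a' b' (h1'.trans h2')
  have i1 := hline a' (hl a' ha'.1)
  have i2 := hline b' (hl b' hb'.1)
  have i3 := hline' a (hl' a ha.1)
  have i4 := hline' b (hl' b hb.1)
  rw [hka'] at i1
  rw [hkb'] at i2
  rw [hka] at i3
  rw [hkb] at i4
  have hm : m = m' := by
    rcases lt_trichotomy m m' with h | h | h
    · nlinarith
    · exact h
    · nlinarith
  subst hm
  have hc : c = c' := by linarith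
  subst hc
  have eq_a : a = a' := by
    rcases lt_trichotomy (conj a * u).re (conj a' * u).re with h | h | h
    · exact absurd ha' (notMem_extremePoints_of_collinear hu0 ha.1 hb.1 hka hkb hka' h
        (h1'.trans h2))
    · exact eq_of_conj_mul_eq hu0 h (by rw [hka, hka', h])
    · exact absurd ha (notMem_extremePoints_of_collinear hu0 ha'.1 hb.1 hka' hkb hka h
        (h1.trans h2))
  have eq_b : b = b' := by
    rcases lt_trichotomy (conj b * u).re (conj b' * u).re with h | h | h
    · exact absurd hb (notMem_extremePoints_of_collinear hu0 ha.1 hb'.1 hka hkb' hkb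
        (h1.trans h2) h)
    · exact eq_of_conj_mul_eq hu0 h (by rw [hkb, hkb', h])
    · exact absurd hb' (notMem_extremePoints_of_collinear hu0 ha.1 hb.1 hka hkb hkb'
        (h1.trans h2') h)
  rw [eq_a, eq_b]

lemma convex_re_conj_mul_le (u : ℂ) (t : ℝ) : Convex ℝ {x : ℂ | (conj x * u).re ≤ t} := by
  intro x hx y hy s r hs hr hsr
  simp only [Set.mem_ofPred_eq] at hx hy ⊢
  have h1 : conj (s • x + r • y) * u = (s : ℂ) * (conj x * u) + (r : ℂ) * (conj y * u) := by
    simp only [Complex.real_smul, map_add, map_mul, Complex.conj_ofReal]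
    ring
  rw [h1, Complex.add_re, Complex.re_ofReal_mul, Complex.re_ofReal_mul]
  have h2 := mul_le_mul_of_nonneg_left hx hs
  have h3 := mul_le_mul_of_nonneg_left hy hr
  have h4 : s * t + r * t = t := by rw [← add_mul, hsr, one_mul]
  linarith

lemma re_conj_mul_le_maxRe {W : Finset ℂ} {x : ℂ}
    (hx : x ∈ convexHull ℝ ((fun a => conj a) '' (W : Set ℂ) ∪ {0})) (u : ℂ) :
    (conj x * u).re ≤ maxRe W u := by
  refine convexHull_min (t := {x : ℂ | (conj x * u).re ≤ maxRe W u}) ?_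
    (convex_re_conj_mul_le u _) hx
  rintro _ (⟨a, ha, rfl⟩ | rfl)
  · simpa using re_le_maxRe ha u
  · simpa using maxRe_nonneg u

/-- With `re_conj_mul_le_maxRe`, this makes `maxRe W` the support function of the hull, approached
at vertices; the conjugation enters because `Re (a u)` is the inner product of `conj a` and `u`. -/
lemma exists_extremePoint_lt {W : Finset ℂ} {u : ℂ} {t : ℝ} (ht : t < maxRe W u) :
    ∃ x ∈ (convexHull ℝ ((fun a => conj a) '' (W : Set ℂ) ∪ {0})).extremePoints ℝ,
      t < (conj x * u).re := by
  by_contra! h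
  have hfin : ((fun a => conj a) '' (W : Set ℂ) ∪ {0}).Finite :=
    (W.finite_toSet.image _).union (Set.finite_singleton 0)
  have h1 : ∀ x ∈ (fun a => conj a) '' (W : Set ℂ) ∪ {0}, (conj x * u).re ≤ t := fun x hx => by
    have hx' := subset_convexHull ℝ _ hx
    rw [← convexHull_extremePoints_convexHull hfin] at hx'
    exact convexHull_min h (convex_re_conj_mul_le u t) hx'
  refine ht.not_ge (maxRe_le_iff.2 ⟨by simpa using h1 0 (Or.inr rfl), fun a ha => ?_⟩)
  simpa using h1 (conj a) (Or.inl ⟨a, ha, rfl⟩)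

/-- The projections of the ascending sides of a polygon onto a line cover its shadow once. -/
lemma sum_orientedSides_eq_width (W : Finset ℂ) {u : ℂ} (hu : Complex.normSq u = 1)
    {S : Finset (ℂ × ℂ)}
    (hS : ∀ e, e ∈ S ↔
      e ∈ orientedSides (convexHull ℝ ((fun a => conj a) '' (W : Set ℂ) ∪ {0}))) :
    ∑ e ∈ S, max (conj (e.2 - e.1) * u).re 0 = maxRe W u + maxRe W (-u) := by
  set V : Set ℂ := (fun a => conj a) '' (W : Set ℂ) ∪ {0}
  have hV : V.Finite := (W.finite_toSet.image _).union (Set.finite_singleton 0)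
  have h1 : ∀ e ∈ S, max (conj (e.2 - e.1) * u).re 0
      = ∫ t, (Set.Ioo (conj e.1 * u).re (conj e.2 * u).re).indicator (fun _ => (1 : ℝ)) t := by
    intro e _
    rw [integral_indicator measurableSet_Ioo, setIntegral_const, smul_eq_mul, mul_one,
      Real.volume_real_Ioo, map_sub, sub_mul, Complex.sub_re]
  have h2 : maxRe W u + maxRe W (-u)
      = ∫ t, (Set.Ioo (-maxRe W (-u)) (maxRe W u)).indicator (fun _ => (1 : ℝ)) t := by
    have := maxRe_nonneg (W := W) u
    have := maxRe_nonneg (W := W) (-u)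
    rw [integral_indicator measurableSet_Ioo, setIntegral_const, smul_eq_mul, mul_one,
      Real.volume_real_Ioo_of_le (by linarith)]
    ring
  have hint : ∀ e ∈ S, Integrable fun t =>
      (Set.Ioo (conj e.1 * u).re (conj e.2 * u).re).indicator (fun _ => (1 : ℝ)) t := fun e _ =>
    (integrable_indicator_iff measurableSet_Ioo).2 (integrableOn_const measure_Ioo_lt_top.ne)
  rw [Finset.sum_congr rfl h1, h2, ← integral_finsetSum S hint]
  refine integral_congr_ae ?_
  have hfin : ((fun x => (conj x * u).re) '' (convexHull ℝ V).extremePoints ℝ).Finite :=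
    (finite_extremePoints_convexHull hV).image _
  -- Outside the finitely many projections of vertices, exactly one ascending side passes over each
  -- `t` in the shadow and none over any other `t`.
  filter_upwards [compl_mem_ae_iff.2 (hfin.measure_zero volume)] with t ht
  by_cases htI : t ∈ Set.Ioo (-maxRe W (-u)) (maxRe W u)
  · obtain ⟨y, hy, hyt⟩ := exists_extremePoint_lt (u := -u) (t := -t) (by linarith [htI.1])
    obtain ⟨e, he, he1, he2⟩ := exists_orientedSide_crossing hV hu
      (fun x hx hxt => ht ⟨x, hx, hxt⟩)
      ⟨y, hy, by rw [mul_neg, Complex.neg_re] at hyt; linarith⟩ (exists_extremePoint_lt htI.2)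
    rw [Set.indicator_of_mem htI, Finset.sum_eq_single_of_mem e ((hS e).2 he),
      Set.indicator_of_mem (show t ∈ Set.Ioo _ _ from ⟨he1, he2⟩)]
    intro e' he' hne
    refine Set.indicator_of_notMem (fun h => hne ?_) _
    exact orientedSide_crossing_unique hu ((hS e').1 he') he h.1 h.2 he1 he2
  · rw [Set.indicator_of_notMem htI]
    refine Finset.sum_eq_zero fun e he => Set.indicator_of_notMem (fun h => htI ?_) _
    obtain ⟨ha, hb, -⟩ := (hS e).1 he
    have h3 := re_conj_mul_le_maxRe ha.1 (-u)
    rw [mul_neg, Complex.neg_re] at h3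
    exact ⟨by linarith [h.1], h.2.trans_le (re_conj_mul_le_maxRe hb.1 u)⟩

/-- Cauchy's formula: the circumference of a polygon is the integral of its support function. -/
theorem circumference_convexHull_eq (W : Finset ℂ) :
    circumference (convexHull ℝ ((fun a => conj a) '' (W : Set ℂ) ∪ {0}))
      = 2 * π * circleAverage (maxRe W) 0 1 := by
  have hV : ((fun a => conj a) '' (W : Set ℂ) ∪ {0}).Finite :=
    (W.finite_toSet.image _).union (Set.finite_singleton 0)
  have hfin := finite_orientedSides hV
  rw [circumference, finsum_mem_eq_finite_toFinset_sum _ hfin]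
  set S := hfin.toFinset
  have h1 : circleAverage (fun z => ∑ e ∈ S, max (conj (e.2 - e.1) * z).re 0) 0 1
      = ∑ e ∈ S, dist e.1 e.2 / π := by
    rw [circleAverage_fun_sum fun e _ => circleIntegrable_of_continuous (by fun_prop) _ _]
    refine Finset.sum_congr rfl fun e _ => ?_
    rw [circleAverage_max_re_mul_zero, Complex.norm_conj, dist_comm, dist_eq_norm]
  -- Averaging the width over all directions: the sides contribute their lengths over `π`, while the
  -- width contributes twice the average of `maxRe`, since `z ↦ -z` preserves circle averages.
  have h2 : circleAverage (fun z => ∑ e ∈ S, max (conj (e.2 - e.1) * z).re 0) 0 1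
      = circleAverage (fun z => maxRe W z + maxRe W (-z)) 0 1 := by
    refine circleAverage_congr_sphere fun z hz => ?_
    rw [abs_one, mem_sphere_zero_iff_norm] at hz
    exact sum_orientedSides_eq_width W (by rw [Complex.normSq_eq_norm_sq, hz]; norm_num)
      fun e => hfin.mem_toFinset
  have h3 : circleAverage (fun z => maxRe W (-z)) 0 1 = circleAverage (maxRe W) 0 1 := by
    unfold circleAverage
    have h4 : ∀ θ : ℝ, -circleMap 0 1 θ = circleMap 0 1 (θ + π) := fun θ => by
      simp only [circleMap_zero, Complex.ofReal_add, add_mul, Complex.exp_add, Complex.exp_pi_mul_I]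
      ring
    simp_rw [h4]
    rw [intervalIntegral.integral_comp_add_right (fun φ => maxRe W (circleMap 0 1 φ)), zero_add,
      add_comm (2 * π), integral_circleMap_eq, circleAverage]
    simp only [smul_eq_mul]
    field_simp
  have h4 := continuous_maxRe W
  rw [h1, circleAverage_fun_add (circleIntegrable_of_continuous h4 _ _)
    (circleIntegrable_of_continuous (by fun_prop) _ _), h3, ← Finset.sum_div,
    div_eq_iff pi_pos.ne'] at h2
  rw [h2]
  ring

/-! ### The asymptotic formula for the characteristic. -/

theorem theorem3p1 (q p m : ℕ) (hp : 1 ≤ p) (hpq : p ≤ q)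
    (H : Fin (m + 1) → ℂ → ℂ) (w : Fin (m + 1) → ℂ) (f : ℂ → ℂ)
    (hw_inj : Function.Injective w)
    (hw_ne : ∀ j, j ≠ 0 → w j ≠ 0)
    (hH_exp : ∀ j, IsExponentialPolynomial (H j))
    (hH_ne : ∀ j, j ≠ 0 → H j ≠ 0)
    (hH_order : ∀ j, growthOrder (H j) ≤ ((q - p : ℕ) : EReal))
    (hf : ∀ z : ℂ, f z = ∑ j, H j z * Complex.exp (w j * z ^ q)) :
    (fun r : ℝ => ValueDistribution.characteristic f ⊤ r
        - circumference (convexHull ℝ (conjLeadingCoeffs H w ∪ {0})) * (r ^ q / (2 * Real.pi)))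
      =O[Filter.atTop] (fun r : ℝ => r ^ (q - p) + Real.log r) := by
  classical
  -- Terms with `H j = 0` count neither for the hull nor for `f`; removing them, possibly including
  -- `j = 0`, gives the nonvanishing that the elimination needs.
  set s : Finset (Fin (m + 1)) := Finset.univ.filter fun j => H j ≠ 0
  have hV : conjLeadingCoeffs H w = (fun a => conj a) '' ((s.image w : Finset ℂ) : Set ℂ) := by
    ext x
    simp [conjLeadingCoeffs, s, eq_comm]
  have hsmall : ∀ j ∈ s, SmallGrowth (q - p) (H j) := fun j _ =>
    (hH_exp j).smallGrowth (hH_order j)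
  have hfs : f = fun z => ∑ j ∈ s, H j z * Complex.exp (w j * z ^ q) := by
    ext z
    have h1 : ∀ j ∈ Finset.univ, H j z * Complex.exp (w j * z ^ q) ≠ 0 → H j ≠ 0 :=
      fun j _ hne h0 => hne (by rw [h0, Pi.zero_apply, zero_mul])
    rw [hf, Finset.sum_filter_of_ne h1]
  have hfd : Differentiable ℂ f := hfs ▸ differentiable_exponentialSum hsmall
  obtain ⟨C, hC⟩ := exists_abs_circleAverage_sub_le hp (Nat.sub_add_cancel hpq)
    hw_inj.injOn hsmall fun j hj => (Finset.mem_filter.1 hj).2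
  rw [hV, circumference_convexHull_eq]
  refine IsBigO.of_bound (|C| * 2) ?_
  filter_upwards [eventually_ge_atTop 4] with r hr
  have hr0 : 0 < r := by linarith
  have h1 := hC r hr
  rw [characteristic_top_eq_circleAverage hfd, hfs]
  have h2 : 2 * π * circleAverage (maxRe (s.image w)) 0 1 * (r ^ q / (2 * π))
      = r ^ q * circleAverage (maxRe (s.image w)) 0 1 := by
    field_simp
  have hlog : 0 ≤ log r := log_nonneg (by linarith)
  have h3 : growthScale (q - p) r ≤ 2 * (r ^ (q - p) + log r) := by
    have h4 : log (r + 2) ≤ log (r ^ 2) := log_le_log (by linarith) (by nlinarith)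
    rw [log_pow] at h4
    have h5 : 0 ≤ r ^ (q - p) := by positivity
    push_cast at h4
    unfold growthScale
    linarith
  have h6 : 0 ≤ r ^ (q - p) + log r := by positivity
  rw [h2, norm_eq_abs, norm_of_nonneg h6]
  calc _ ≤ C * growthScale (q - p) r := h1
    _ ≤ |C| * (2 * (r ^ (q - p) + log r)) :=
      mul_le_mul (le_abs_self C) h3 (growthScale_pos _ hr0.le).le (abs_nonneg C)
    _ = _ := by ring
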